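/- **Setting.** Let $x=(x_1,\dots,x_n)\in\mathbb R^p$ with blocks $x_j\in\mathbb R^{p_j}$ and $y=(y_1,\dots,y_m)\in\mathbb R^d$ with blocks $y_i\in\mathbb R^{d_i}$ ($n,m\ge 1$), with Euclidean norms. Consider $$F^\star=\min_{x}\{F(x)=f(x)+h(x)+g(Kx)\},\qquad \min_y\{G(y)=\phi^*(-K^\top y)+g^*(y)\},\qquad \phi=f+h,$$ where $K\in\mathbb R^{d\times p}$, $^*$ denotes the Fenchel conjugate, and - $f(x)=\sum_{j=1}^n f_j(x_j)$, each $f_j:\mathbb R^{p_j}\to\mathbb R\cup\{+\infty\}$ is proper, closed and $\mu_{f_j}$-strongly convex with $\mu_{f_j}>0$; - $g(y)=\sum_{i=1}^m g_i(y_i)$, each $g_i:\mathbb R^{d_i}\to\mathbb R\cup\{+\infty\}$ is proper, closed and convex, and $g$ is $M_g$-Lipschitz continuous on all of $\mathbb R^d$ (hence finite everywhere, so the Slater condition $0\in\mathrm{ri}(\mathrm{dom}\,g-K\,\mathrm{dom}\,\phi)$ holds); - $h:\mathbb R^p\to\mathbb R$ is convex and differentiable, and for each $j$ the partial gradient $\nabla_{x_j}h$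 is $L_j^h$-Lipschitz with respect to changes of the $j$-th block, $L^h_j\ge0$; - the set of minimizers of $F$ is nonempty. Let $\sigma\in\mathbb R^n_{++}$, let $q_j=\frac1n$ for $j=1,\dots,n$, and let $\hat q$ be a probability vector on $\{1,\dots,m\}$ with positive entries. Put $$\bar L_\sigma=\|K\,\mathrm{diag}(1/\sqrt\sigma)\|^2,\quad L^h_\sigma=\max_j\tfrac{L_j^h}{\sigma_j},\quad \mu^f_\sigma=\min_j\tfrac{\mu_{f_j}}{\sigma_j},\quad \tau_0=\min\{\min_i\hat q_i,\min_j q_j\},\quad \|x\|_{\sigma/q}^2=\sum_j\tfrac{\sigma_j}{q_j}\|x_j\|^2,$$ and assume $\bar L_\sigma+L^h_\sigma>0$. Let $\rho_0>0$ with $8\bar L_\sigma\rho_0\le\mu^f_\sigma$, let $c>2$ with $c\tau_0>2$, and for $k\ge 0$ $$\tau_k=\frac{c\tau_0}{k+c},\qquad \rho_k=\frac{\rho_0\tau_0^2}{\tau_k^2},\qquad \beta_k=\frac1{2\bar L_\sigma\rho_k+L^h_\sigma},\qquad \eta_k=\frac{\rho_k}2 .$$ **Algorithm.** Let $x^0$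 satisfy $F(x^0)<+\infty$ and let $\hat y^0\in\mathbb R^d$. Set $\tilde x^0=x^0$, $y^0=\bar y^0=\hat y^0$. For $k=0,1,\dots$: $\hat x^k=(1-\tau_k)x^k+\tau_k\tilde x^k$; $\;y^{k+1}=\mathrm{prox}_{\rho_kg^*}(\hat y^k+\rho_kK\hat x^k)$; draw $j_k\in\{1,\dots,n\}$ with $\mathbb P(j_k=j)=q_j$, independently of all other draws; put $\tilde x^{k+1}_j=\tilde x^k_j$ for $j\ne j_k$ and, for $j=j_k$, $$\tilde x_j^{k+1}=\mathrm{prox}_{\frac{\tau_0\beta_k}{\sigma_j\tau_k}f_j}\Big(\tilde x^k_j-\tfrac{\tau_0\beta_k}{\sigma_j\tau_k}\big[\nabla_{x_j}h(\hat x^k)+K_j^\top y^{k+1}\big]\Big),$$ where $K_j$ is the $j$-th column block of $K$; $\;x^{k+1}=\hat x^k+\frac{\tau_k}{\tau_0}(\tilde x^{k+1}-\tilde x^k)$; with $\Theta_k=K[x^{k+1}-\hat x^k-(1-\tau_k)(x^k-\hat x^{k-1})]$, $$\hat y^{k+1}=\tfrac{\eta_k(1-\tau_k)}{\rho_{k-1}}\hat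 y^{k-1}+\big(1-\tfrac{\eta_k}{\rho_k}\big)\hat y^k+\tfrac{\eta_k}{\rho_k}y^{k+1}+\eta_k\Theta_k-\tfrac{\eta_k(1-\tau_k)}{\rho_{k-1}}y^k$$ (for $k=0$ with $\rho_{-1}:=\rho_0$, $\hat y^{-1}:=\hat y^0$, $\hat x^{-1}:=x^0$); $\;\bar y^{k+1}=(1-\tau_k)\bar y^k+\tau_ky^{k+1}$. Here $\mathrm{prox}_{\gamma\psi}(z)=\arg\min_u\{\gamma\psi(u)+\frac12\|u-z\|^2\}$. **Theorem.** For every $k\ge0$, $F(x^k)$ is almost surely finite and integrable, and for every minimizer $x^\star$ of $F$ and every minimizer $y^\star$ of $G$, $$\mathbb E[F(x^k)-F^\star]\le\frac{c^2\bar{\mathcal E}_0^2+c^2(M_g+\|y^\star\|)\,\bar{\mathcal E}_0\sqrt{2/\rho_0}}{(k+c-1)^2},$$ where $\bar{\mathcal E}_0\ge 0$ and $$\bar{\mathcal E}_0^2=F(x^0)-F^\star+\frac{\tau_0(L^h_\sigma+2\bar L_\sigma\rho_0+\mu^f_\sigma)}2\|x^0-x^\star\|^2_{\sigma/q}+\frac1{\rho_0}\|\hat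 y^0-y^\star\|^2.$$ Moreover $$\liminf_{k\to\infty}\;k^2\sqrt{\log k}\;\mathbb E[F(x^k)-F^\star]=0,$$ that is, $\mathbb E[F(x^k)]-F^\star=\underline{o}\big(1/(k^2\sqrt{\log k})\big)$, where $u_k=\underline o(v_k)$ means $\liminf_{k\to\infty}u_k/v_k=0$. -/

import Mathlib

open MeasureTheory ProbabilityTheory Filter Topology

noncomputable section

namespace SemiRandPD

section ConvexAnalysis

variable {E : Type*} [NormedAddCommGroup E] [InnerProductSpace ℝ E]

/-- A proper extended-real-valued function: nowhere `-∞` and not identically `+∞`. -/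
def IsProper (f : E → EReal) : Prop :=
  (∀ x, f x ≠ ⊥) ∧ ∃ x, f x ≠ ⊤

/-- A closed function is a lower semicontinuous one. -/
def IsClosedFun (f : E → EReal) : Prop :=
  LowerSemicontinuous f

/-- An extended-real-valued function is convex when its epigraph is convex. -/
def IsConvexFun (f : E → EReal) : Prop :=
  Convex ℝ {z : E × ℝ | f z.1 ≤ (z.2 : EReal)}

/-- `μ`-strong convexity: `f - (μ / 2) ‖·‖²` is convex. -/
def IsStronglyConvexFun (μ : ℝ) (f : E → EReal) : Prop :=
  IsConvexFun fun x => f x - ((μ / 2 * ‖x‖ ^ 2 : ℝ) : EReal)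

/-- `M`-Lipschitz continuity on the whole space.  A proper function with this property is finite
everywhere and satisfies `|f x - f y| ≤ M ‖x - y‖`. -/
def IsLipschitzFun (M : ℝ) (f : E → EReal) : Prop :=
  0 ≤ M ∧ ∀ x y, f x ≤ f y + ((M * ‖x - y‖ : ℝ) : EReal)

/-- The Fenchel conjugate `f*(y) = sup_x (⟪y, x⟫ - f x)`. -/
def conjugate (f : E → EReal) (y : E) : EReal :=
  ⨆ x, (((inner ℝ y x : ℝ) : EReal) - f x)

/-- `u = prox_{γ f}(z)`, that is, `u` minimizes `γ f(v) + (1/2) ‖v - z‖²` over `v`.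
For `γ > 0` and `f` proper, closed and convex there is exactly one such `u`. -/
def IsProx (γ : ℝ) (f : E → EReal) (z u : E) : Prop :=
  ∀ v, (γ : EReal) * f u + ((‖u - z‖ ^ 2 / 2 : ℝ) : EReal)
    ≤ (γ : EReal) * f v + ((‖v - z‖ ^ 2 / 2 : ℝ) : EReal)

end ConvexAnalysis

/-- The Euclidean space of vectors made of `n` blocks, the `j`-th one in `ℝ^{p_j}`. -/
abbrev BlockSpace {n : ℕ} (p : Fin n → ℕ) : Type :=
  PiLp 2 fun j => EuclideanSpace ℝ (Fin (p j))

/-- The embedding `U_j` of the `j`-th block: `d` in block `j`, zero in all other blocks. -/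
def blockEmbed {n : ℕ} {p : Fin n → ℕ} (j : Fin n) (d : EuclideanSpace ℝ (Fin (p j))) :
    BlockSpace p :=
  WithLp.toLp 2 (Pi.single j d)

/-- The block-diagonal map `x ↦ (w_j x_j)_j`. -/
def blockDiag {n : ℕ} (p : Fin n → ℕ) (w : Fin n → ℝ) : BlockSpace p →L[ℝ] BlockSpace p :=
  LinearMap.toContinuousLinearMap
    { toFun := fun x => WithLp.toLp 2 fun j => w j • x j
      map_add' := fun x y => by ext j; simp
      map_smul' := fun a x => by ext j; simp; ring }

/-- The weighted squared norm `∑_j w_j ‖x_j‖²`. -/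
def wnormSq {n : ℕ} {p : Fin n → ℕ} (w : Fin n → ℝ) (x : BlockSpace p) : ℝ :=
  ∑ j, w j * ‖x j‖ ^ 2

/-- The data of the composite problem `min_x f(x) + h(x) + g(K x)` with
`f(x) = ∑_j f_j(x_j)` and `g(y) = ∑_i g_i(y_i)`. -/
structure Problem (n m : ℕ) (p : Fin n → ℕ) (d : Fin m → ℕ) where
  fj : ∀ j, EuclideanSpace ℝ (Fin (p j)) → EReal
  gi : ∀ i, EuclideanSpace ℝ (Fin (d i)) → EReal
  h : BlockSpace p → ℝ
  K : BlockSpace p →L[ℝ] BlockSpace d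

namespace Problem

variable {n m : ℕ} {p : Fin n → ℕ} {d : Fin m → ℕ} (Q : Problem n m p d)

def f (x : BlockSpace p) : EReal := ∑ j, Q.fj j (x j)

def g (y : BlockSpace d) : EReal := ∑ i, Q.gi i (y i)

/-- `φ = f + h`. -/
def phi (x : BlockSpace p) : EReal := Q.f x + (Q.h x : EReal)

/-- The primal objective `F(x) = f(x) + h(x) + g(K x)`. -/
def F (x : BlockSpace p) : EReal := Q.phi x + Q.g (Q.K x)

/-- The dual objective `G(y) = φ*(-Kᵀ y) + g*(y)`. -/
def G (y : BlockSpace d) : EReal :=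
  conjugate Q.phi (-(ContinuousLinearMap.adjoint Q.K y)) + conjugate Q.g y

/-- `F* = inf_x F(x)`. -/
def Fstar : EReal := ⨅ x, Q.F x

def IsPrimalSolution (x : BlockSpace p) : Prop := ∀ x', Q.F x ≤ Q.F x'

def IsDualSolution (y : BlockSpace d) : Prop := ∀ y', Q.G y ≤ Q.G y'

/-- The standing assumptions on the functions: each `f_j` is proper, closed and `μ_j`-strongly
convex with `μ_j > 0`; each `g_i` is proper, closed and convex; `h` is convex and differentiable,
and its `j`-th partial gradient is `L_j`-Lipschitz in the `j`-th block. -/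
structure Assumptions (μ L : Fin n → ℝ) : Prop where
  fj_proper : ∀ j, IsProper (Q.fj j)
  fj_closed : ∀ j, IsClosedFun (Q.fj j)
  μ_pos : ∀ j, 0 < μ j
  fj_strong : ∀ j, IsStronglyConvexFun (μ j) (Q.fj j)
  gi_proper : ∀ i, IsProper (Q.gi i)
  gi_closed : ∀ i, IsClosedFun (Q.gi i)
  gi_convex : ∀ i, IsConvexFun (Q.gi i)
  h_convex : ConvexOn ℝ Set.univ Q.h
  h_diff : Differentiable ℝ Q.h
  L_nonneg : ∀ j, 0 ≤ L j
  h_smooth : ∀ (j : Fin n) (x : BlockSpace p) (t : EuclideanSpace ℝ (Fin (p j))),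
    ‖gradient Q.h (x + blockEmbed j t) j - gradient Q.h x j‖ ≤ L j * ‖t‖

/-- `L̄_σ = ‖K diag(1/√σ)‖²` (operator norm). -/
def Lbar (σ : Fin n → ℝ) : ℝ :=
  ‖Q.K.comp (blockDiag p fun j => 1 / √(σ j))‖ ^ 2

end Problem

/-- `L^h_σ = max_j L_j / σ_j`. -/
def Lh {n : ℕ} (L σ : Fin n → ℝ) : ℝ := ⨆ j, L j / σ j

/-- `μ^f_σ = min_j μ_j / σ_j`. -/
def muF {n : ℕ} (μ σ : Fin n → ℝ) : ℝ := ⨅ j, μ j / σ j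

/-- `τ₀ = min {min_i q̂_i, min_j q_j}`. -/
def tau0 {n m : ℕ} (qhat : Fin m → ℝ) (q : Fin n → ℝ) : ℝ := min (⨅ i, qhat i) (⨅ j, q j)

/-- A probability vector with positive entries. -/
def IsPosProb {n : ℕ} (q : Fin n → ℝ) : Prop := (∀ j, 0 < q j) ∧ ∑ j, q j = 1

/-- The parameter sequences used by the algorithm. -/
structure Params where
  τ : ℕ → ℝ
  ρ : ℕ → ℝ
  β : ℕ → ℝ
  η : ℕ → ℝ

/-- `τ_k = c τ₀ / (k + c)`, `ρ_k = ρ₀ τ₀² / τ_k²`, `β_k = 1 / (2 L̄_σ ρ_k + L^h_σ)` and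
`η_k = ρ_k / 2`, where `t0`, `Lb`, `Lσ` stand for `τ₀`, `L̄_σ`, `L^h_σ`. -/
def paramRule (c t0 ρ0 Lb Lσ : ℝ) : Params where
  τ := fun k => c * t0 / (k + c)
  ρ := fun k => ρ0 * t0 ^ 2 / (c * t0 / (k + c)) ^ 2
  β := fun k => 1 / (2 * Lb * (ρ0 * t0 ^ 2 / (c * t0 / (k + c)) ^ 2) + Lσ)
  η := fun k => ρ0 * t0 ^ 2 / (c * t0 / (k + c)) ^ 2 / 2

/-- The iterates of the semi-randomized primal-dual algorithm: `x = x^k`, `xt = x̃^k`,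
`xh = x̂^k`, `y = y^k`, `yh = ŷ^k`, `yb = ȳ^k`. -/
structure Iterates {n m : ℕ} (p : Fin n → ℕ) (d : Fin m → ℕ) where
  x : ℕ → BlockSpace p
  xt : ℕ → BlockSpace p
  xh : ℕ → BlockSpace p
  y : ℕ → BlockSpace d
  yh : ℕ → BlockSpace d
  yb : ℕ → BlockSpace d

/-- `S` is the run of the semi-randomized primal-dual algorithm on `Q` from `(x0, yh0)` with
parameters `A`, when the block drawn at iteration `k` is `jk k`.

In the multiplier update the index `k - 1` is truncated at `k = 0`.  This realizes the conventions
`ρ_{-1} = ρ_0`, `ŷ^{-1} = ŷ^0` and `x̂^{-1} = x^0` (note that `x̂^0 = x^0`), so that for `k = 0` the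
terms that refer to the past vanish. -/
structure IsRun {n m : ℕ} {p : Fin n → ℕ} {d : Fin m → ℕ} (Q : Problem n m p d)
    (σ : Fin n → ℝ) (t0 : ℝ) (A : Params) (x0 : BlockSpace p) (yh0 : BlockSpace d)
    (jk : ℕ → Fin n) (S : Iterates p d) : Prop where
  x_zero : S.x 0 = x0
  xt_zero : S.xt 0 = x0
  yh_zero : S.yh 0 = yh0
  y_zero : S.y 0 = yh0
  yb_zero : S.yb 0 = yh0
  xh_eq : ∀ k, S.xh k = (1 - A.τ k) • S.x k + A.τ k • S.xt k
  y_succ : ∀ k, IsProx (A.ρ k) (conjugate Q.g) (S.yh k + A.ρ k • Q.K (S.xh k)) (S.y (k + 1))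
  xt_keep : ∀ k j, j ≠ jk k → S.xt (k + 1) j = S.xt k j
  xt_draw : ∀ k j, j = jk k →
    IsProx (t0 * A.β k / (σ j * A.τ k)) (Q.fj j)
      (S.xt k j - (t0 * A.β k / (σ j * A.τ k)) •
        (gradient Q.h (S.xh k) j + ContinuousLinearMap.adjoint Q.K (S.y (k + 1)) j))
      (S.xt (k + 1) j)
  x_succ : ∀ k, S.x (k + 1) = S.xh k + (A.τ k / t0) • (S.xt (k + 1) - S.xt k)
  yh_succ : ∀ k, S.yh (k + 1) =
    (A.η k * (1 - A.τ k) / A.ρ (k - 1)) • S.yh (k - 1)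
      + (1 - A.η k / A.ρ k) • S.yh k
      + (A.η k / A.ρ k) • S.y (k + 1)
      + A.η k • Q.K (S.x (k + 1) - S.xh k - (1 - A.τ k) • (S.x k - S.xh (k - 1)))
      - (A.η k * (1 - A.τ k) / A.ρ (k - 1)) • S.y k
  yb_succ : ∀ k, S.yb (k + 1) = (1 - A.τ k) • S.yb k + A.τ k • S.y (k + 1)

/-- The constant
`Ē₀² = F(x⁰) - F* + (τ₀ (L^h_σ + 2 L̄_σ ρ₀ + μ^f_σ) / 2) ‖x⁰ - x*‖²_{σ/q} + (1/ρ₀) ‖ŷ⁰ - y*‖²`. -/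
def E0sq {n m : ℕ} {p : Fin n → ℕ} {d : Fin m → ℕ} (Q : Problem n m p d)
    (μ L σ q : Fin n → ℝ) (t0 ρ0 : ℝ) (x0 xs : BlockSpace p) (yh0 ys : BlockSpace d) : ℝ :=
  ((Q.F x0).toReal - Q.Fstar.toReal)
    + t0 * (Lh L σ + 2 * Q.Lbar σ * ρ0 + muF μ σ) / 2 * wnormSq (fun j => σ j / q j) (x0 - xs)
    + 1 / ρ0 * ‖yh0 - ys‖ ^ 2

/-- `u_k = o(v_k)` in the sense `liminf_k u_k / v_k = 0`, the lower limit being taken in the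
extended reals. -/
def IsLiminfLittleO (u v : ℕ → ℝ) : Prop :=
  liminf (fun k => ((u k / v k : ℝ) : EReal)) atTop = 0

end SemiRandPD

end

/-! The method is an accelerated augmented Lagrangian scheme in disguise. By Moreau's identity
`y^{k+1}` is a subgradient of `g` at an auxiliary point `r^{k+1}`, and `ŷ` moves by `ρ_k/2` times
the difference of the new residual `K x^{k+1} - r^{k+1}` and `1 - τ_k` times the old one. The
problem thus becomes the minimization of `f(x) + h(x) + g(r)` subject to `K x = r`, and a dual
solution is a multiplier of this constraint, by a Hahn–Banach separation.

One iteration, averaged over the drawn block, shrinks the Lagrangian gap by `1 - τ_k` and the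
squared residual by `(1 - τ_k)²`, up to telescoping distances (`average_iteration_le`). This
combines the proximal inequality on one block, the block descent lemma for `h`, the gradient
inequalities for `h` and `g`, and an exact identity for the dual step. The step size absorbs both
the smoothness of `h` and the penalty curvature. The values `f(x^k)` are replaced by `averagedF`, an
upper bound that is affine in the values `f(x̃^l)` and hence can be averaged over one draw.

Write `s_k = τ₀/τ_{k-1}` and multiply by `s_{k+1}²`. Since `c τ₀ > 2`, a Lyapunov function decreases
in expectation, with a surplus proportional to `s_{k+1} (gap + (ρ₀/2) s_k² ‖residual‖²)`; strong
convexity with `8 L̄ ρ₀ ≤ μ` pays for the growing penalty (`lyapunov_coefficients`). Boundedness of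
the Lyapunov function gives the `1/k²` bound, because `F - F*` is at most the gap plus `(M_g + ‖y*‖)
‖residual‖`.

Summing the surplus shows that `k a_k` and `k³ b_k` are summable, with `a_k` the expected gap and
`b_k` the expected squared residual. As `∑ 1/(k log k)` diverges, `k² log k · a_k` and `k⁴ log k ·
b_k` are simultaneously small along a subsequence. The objective error involves `√b_k`, and this
square root turns `log k` into `√(log k)`.

Probability enters only through finite words: the first `k` draws determine the first `k`
iterations, so every expectation is a finite average. -/

noncomputable section

namespace SemiRandPD

/-! ### Convex analysis: strong convexity, proximal points, multipliers, conjugates. -/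

section ConvexTools

variable {E : Type*} [NormedAddCommGroup E] [InnerProductSpace ℝ E]

/-- The effective domain of an extended-real-valued function. -/
def effDom (f : E → EReal) : Set E := {x | f x ≠ ⊤}

lemma toReal_le_of_le_coe {a : EReal} {r : ℝ} (h : a ≤ (r : EReal)) (hb : a ≠ ⊥) :
    a.toReal ≤ r := by
  have := EReal.toReal_le_toReal h hb (EReal.coe_ne_top r)
  rwa [EReal.toReal_coe] at this

lemma convexOn_toReal {f : E → EReal} (hbot : ∀ x, f x ≠ ⊥) (hf : IsConvexFun f) :
    ConvexOn ℝ (effDom f) fun x => (f x).toReal := by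
  have key : ∀ x ∈ effDom f, ∀ y ∈ effDom f, ∀ a b : ℝ, 0 ≤ a → 0 ≤ b → a + b = 1 →
      f (a • x + b • y) ≤ ((a * (f x).toReal + b * (f y).toReal : ℝ) : EReal) := by
    intro x hx y hy a b ha hb hab
    have hx' : (x, (f x).toReal) ∈ {z : E × ℝ | f z.1 ≤ (z.2 : EReal)} := EReal.le_coe_toReal hx
    have hy' : (y, (f y).toReal) ∈ {z : E × ℝ | f z.1 ≤ (z.2 : EReal)} := EReal.le_coe_toReal hy
    simpa using! hf hx' hy' ha hb hab
  refine ⟨fun x hx y hy a b ha hb hab => ?_, fun x hx y hy a b ha hb hab => ?_⟩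
  · exact ((key x hx y hy a b ha hb hab).trans_lt (EReal.coe_lt_top _)).ne
  · have h := key x hx y hy a b ha hb hab
    simpa only [smul_eq_mul] using toReal_le_of_le_coe h (hbot _)

lemma strongConvexOn_toReal {f : E → EReal} {μ : ℝ} (hbot : ∀ x, f x ≠ ⊥)
    (hf : IsStronglyConvexFun μ f) : StrongConvexOn (effDom f) μ fun x => (f x).toReal := by
  have hsub : ∀ x, ∀ r : ℝ, f x ≠ ⊤ → f x - (r : EReal) = (((f x).toReal - r : ℝ) : EReal) := by
    intro x r hx
    rw [EReal.coe_sub, EReal.coe_toReal hx (hbot x)]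
  have hdom : effDom (fun x => f x - ((μ / 2 * ‖x‖ ^ 2 : ℝ) : EReal)) = effDom f := by
    ext x
    by_cases hx : f x = ⊤
    · simp only [effDom, Set.mem_ofPred_eq, hx, EReal.top_sub_coe]
    · have h1 : f x - ((μ / 2 * ‖x‖ ^ 2 : ℝ) : EReal) ≠ ⊤ := by
        rw [hsub x _ hx]; exact EReal.coe_ne_top _
      simp only [effDom, Set.mem_ofPred_eq]
      exact ⟨fun _ => hx, fun _ => h1⟩
  have h := convexOn_toReal (f := fun x => f x - ((μ / 2 * ‖x‖ ^ 2 : ℝ) : EReal)) (fun x => by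
    by_cases hx : f x = ⊤
    · simp only [hx, EReal.top_sub_coe]; exact top_ne_bot
    · rw [hsub x _ hx]; exact EReal.coe_ne_bot _) hf
  rw [hdom] at h
  rw [strongConvexOn_iff_convex]
  refine h.congr fun x hx => ?_
  simp only [hsub x _ hx, EReal.toReal_coe]

/-- Strong convexity on the segment from `u` to `v`, combined with minimality of `u`, gives the
claim with a factor `1 - t` on the quadratic; then `t → 0`. -/
lemma add_le_of_strongConvexOn {s : Set E} {m : ℝ} {ψ : E → ℝ}
    (hψ : StrongConvexOn s m ψ) {u v : E} (hu : u ∈ s) (hv : v ∈ s) (hmin : ∀ w ∈ s, ψ u ≤ ψ w) :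
    ψ u + m / 2 * ‖u - v‖ ^ 2 ≤ ψ v := by
  have h : ∀ t ∈ Set.Ioo (0 : ℝ) 1, ψ u + (1 - t) * (m / 2 * ‖u - v‖ ^ 2) ≤ ψ v := by
    intro t ht
    have h1 := hψ.2 hu hv (sub_nonneg.2 ht.2.le) ht.1.le (by ring)
    have h2 := hmin _ (hψ.1 hu hv (sub_nonneg.2 ht.2.le) ht.1.le (by ring))
    simp only [smul_eq_mul] at h1
    have h3 : t * (ψ u + (1 - t) * (m / 2 * ‖u - v‖ ^ 2)) ≤ t * ψ v := by nlinarith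
    exact le_of_mul_le_mul_left h3 ht.1
  have hlim : Tendsto (fun t : ℝ => ψ u + (1 - t) * (m / 2 * ‖u - v‖ ^ 2)) (𝓝[>] 0)
      (𝓝 (ψ u + (1 - 0) * (m / 2 * ‖u - v‖ ^ 2))) := by
    apply tendsto_nhdsWithin_of_tendsto_nhds
    exact Continuous.tendsto (by fun_prop) 0
  have := le_of_tendsto hlim (by
    filter_upwards [Ioo_mem_nhdsGT (zero_lt_one (α := ℝ))] with t ht using h t ht)
  simpa using this

/-- A squared distance satisfies its strong convexity inequality with equality, so the two moduli
simply add. -/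
lemma strongConvexOn_prox_objective {s : Set E} {m γ : ℝ} {ψ : E → ℝ} (hγ : 0 < γ)
    (hψ : StrongConvexOn s m ψ) (z : E) :
    StrongConvexOn s (1 + γ * m) fun v => γ * ψ v + ‖v - z‖ ^ 2 / 2 := by
  refine ⟨hψ.1, fun x hx y hy a b ha hb hab => ?_⟩
  have h1 := mul_le_mul_of_nonneg_left (hψ.2 hx hy ha hb hab) hγ.le
  have h2 : ‖a • x + b • y - z‖ ^ 2 = a * ‖x - z‖ ^ 2 + b * ‖y - z‖ ^ 2 - a * b * ‖x - y‖ ^ 2 := by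
    have e1 : a • x + b • y - z = a • (x - z) + b • (y - z) := by
      have : z = (a + b) • z := by rw [hab, one_smul]
      nth_rewrite 1 [this]
      simp only [smul_sub, add_smul]; abel
    have e2 : x - y = (x - z) - (y - z) := by abel
    rw [e1, e2, norm_add_sq_real, norm_sub_sq_real (x - z), norm_smul, norm_smul, inner_smul_left,
      inner_smul_right]
    simp only [Real.norm_eq_abs, mul_pow, sq_abs, conj_trivial]
    obtain rfl : b = 1 - a := by linarith
    ring
  simp only [smul_eq_mul] at h1 ⊢
  rw [h2]
  nlinarith

lemma IsProx.mem_effDom {E : Type*} [NormedAddCommGroup E] {γ : ℝ} {f : E → EReal} {z u : E}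
    (hγ : 0 < γ) (hbot : ∀ x, f x ≠ ⊥)
    {v : E} (hv : v ∈ effDom f) (h : IsProx γ f z u) : u ∈ effDom f := by
  intro hu
  have h1 := h v
  rw [hu, EReal.coe_mul_top_of_pos hγ, EReal.top_add_coe, ← EReal.coe_toReal hv (hbot v),
    ← EReal.coe_mul, ← EReal.coe_add] at h1
  exact EReal.coe_ne_top _ (top_le_iff.1 h1)

/-- The three-point inequality for the proximal operator of a strongly convex function. -/
lemma IsProx.three_point {γ μ : ℝ} {f : E → EReal} {z u : E} (hγ : 0 < γ)
    (hbot : ∀ x, f x ≠ ⊥) (hf : StrongConvexOn (effDom f) μ fun x => (f x).toReal)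
    (h : IsProx γ f z u) {v : E} (hv : v ∈ effDom f) :
    γ * (f u).toReal + ‖u - z‖ ^ 2 / 2 + (1 + γ * μ) / 2 * ‖u - v‖ ^ 2
      ≤ γ * (f v).toReal + ‖v - z‖ ^ 2 / 2 := by
  have hu := h.mem_effDom hγ hbot hv
  refine add_le_of_strongConvexOn (strongConvexOn_prox_objective hγ hf z) hu hv fun w hw => ?_
  have h1 := h w
  rw [← EReal.coe_toReal hu (hbot u), ← EReal.coe_toReal hw (hbot w), ← EReal.coe_mul,
    ← EReal.coe_mul, ← EReal.coe_add, ← EReal.coe_add] at h1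
  exact_mod_cast h1

lemma IsProx.unique {γ μ : ℝ} {f : E → EReal} {z u u' : E} (hγ : 0 < γ) (hμ : 0 ≤ μ)
    (hbot : ∀ x, f x ≠ ⊥) (hne : (effDom f).Nonempty)
    (hf : StrongConvexOn (effDom f) μ fun x => (f x).toReal)
    (h : IsProx γ f z u) (h' : IsProx γ f z u') : u = u' := by
  obtain ⟨v, hv⟩ := hne
  have h1 := h.three_point hγ hbot hf (h'.mem_effDom hγ hbot hv)
  have h2 := h'.three_point hγ hbot hf (h.mem_effDom hγ hbot hv)
  rw [norm_sub_rev u' u] at h2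
  have h3 : (1 + γ * μ) * ‖u - u'‖ ^ 2 ≤ 0 := by linarith
  have h4 : 0 < 1 + γ * μ := by positivity
  have h5 : ‖u - u'‖ ^ 2 ≤ 0 := nonpos_of_mul_nonpos_right h3 h4
  have h6 : ‖u - u'‖ = 0 := by nlinarith [norm_nonneg (u - u')]
  exact sub_eq_zero.1 (norm_eq_zero.1 h6)

/-- Fenchel–Rockafellar multipliers: at a minimizer of `φ + g ∘ K` with `g` finite and continuous,
the perturbed problem has an affine minorant. -/
lemma exists_multiplier {H : Type*} [NormedAddCommGroup H] [InnerProductSpace ℝ H]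
    [CompleteSpace H] {D : Set E} {φ : E → ℝ} {g : H → ℝ} (K : E →L[ℝ] H)
    (hφ : ConvexOn ℝ D φ) (hg : ConvexOn ℝ Set.univ g) (hgc : Continuous g) {xs : E}
    (hxs : xs ∈ D) (hmin : ∀ x ∈ D, φ xs + g (K xs) ≤ φ x + g (K x)) :
    ∃ y : H, ∀ x ∈ D, ∀ u : H, φ xs + g (K xs) + inner ℝ y u ≤ φ x + g (K x + u) := by
  set F := φ xs + g (K xs) with hF
  -- This is the strict epigraph of the value function `u ↦ inf_x φ x + g (K x + u)`. It is open
  -- because `g` is finite and continuous, so the separation needs no further qualification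
  -- condition.
  let C : Set (H × ℝ) := {z | ∃ x ∈ D, φ x + g (K x + z.1) < z.2}
  have hCo : IsOpen C := by
    have : C = ⋃ x ∈ D, {z : H × ℝ | φ x + g (K x + z.1) < z.2} := by
      ext z; simp [C]
    rw [this]
    exact isOpen_biUnion fun x _ => isOpen_lt (by fun_prop) (by fun_prop)
  have hCc : Convex ℝ C := by
    rintro z ⟨x, hx, hz⟩ z' ⟨x', hx', hz'⟩ a b ha hb hab
    refine ⟨a • x + b • x', hφ.1 hx hx' ha hb hab, ?_⟩
    have h1 := hφ.2 hx hx' ha hb hab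
    have h2 := hg.2 (Set.mem_univ (K x + z.1)) (Set.mem_univ (K x' + z'.1)) ha hb hab
    have e : K (a • x + b • x') + (a • z + b • z').1 = a • (K x + z.1) + b • (K x' + z'.1) := by
      simp only [map_add, map_smul, Prod.fst_add, Prod.smul_fst, smul_add]; abel
    rw [e]
    simp only [smul_eq_mul, Prod.snd_add, Prod.smul_snd] at h1 h2 ⊢
    rcases ha.eq_or_lt with rfl | ha'
    · obtain rfl : b = 1 := by linarith
      linarith
    · nlinarith
  have h0 : ((0 : H), F) ∉ C := by
    rintro ⟨x, hx, h⟩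
    have := hmin x hx
    simp only [add_zero] at h
    linarith
  obtain ⟨ℓ, hℓ⟩ := geometric_hahn_banach_open_point hCc hCo h0
  set s := ℓ (0, 1) with hs
  have hsplit : ∀ u : H, ∀ t : ℝ, ℓ (u, t) = ℓ (u, 0) + t * s := by
    intro u t
    have : ((u, t) : H × ℝ) = (u, 0) + t • (0, 1) := by ext <;> simp
    rw [this, map_add, map_smul, smul_eq_mul]
  -- The separating hyperplane is not vertical: the point directly above `(0, F)` lies in `C`.
  -- Dividing by `-s` turns the functional into a slope.
  have hsneg : s < 0 := by
    have h1 := hℓ (0, F + 1) ⟨xs, hxs, by simp [hF]⟩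
    rw [hsplit 0 (F + 1), hsplit 0 F] at h1
    linarith
  let ξ : H →L[ℝ] ℝ := ℓ.comp (ContinuousLinearMap.inl ℝ H ℝ)
  refine ⟨(-s)⁻¹ • (InnerProductSpace.toDual ℝ H).symm ξ, fun x hx u => ?_⟩
  rw [inner_smul_left, InnerProductSpace.toDual_symm_apply]
  have hξ : ξ u = ℓ (u, 0) := rfl
  have h00 : ℓ ((0 : H), (0 : ℝ)) = 0 := map_zero ℓ
  refine le_of_forall_pos_le_add fun ε hε => ?_
  have h1 := hℓ (u, φ x + g (K x + u) + ε) ⟨x, hx, by simpa using hε⟩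
  rw [hsplit u, hsplit 0 F, h00, ← hξ] at h1
  simp only [conj_trivial]
  have h2 : (-s)⁻¹ * ξ u < φ x + g (K x + u) + ε - F := by
    rw [inv_mul_lt_iff₀ (neg_pos.2 hsneg)]
    linarith
  linarith

/-- A subgradient at `r` is a multiplier for the problem whose only feasible point is `r`. -/
lemma exists_subgradient {H : Type*} [NormedAddCommGroup H] [InnerProductSpace ℝ H]
    [CompleteSpace H] {g : H → ℝ} (hg : ConvexOn ℝ Set.univ g) (hgc : Continuous g) (r : H) :
    ∃ y : H, ∀ s, g r + inner ℝ y (s - r) ≤ g s := by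
  obtain ⟨y, hy⟩ := exists_multiplier (E := H) (D := {r}) (φ := fun _ => (0 : ℝ))
    (ContinuousLinearMap.id ℝ H) (convexOn_const 0 (convex_singleton r)) hg hgc
    (Set.mem_singleton r) (by rintro x rfl; exact le_rfl)
  refine ⟨y, fun s => ?_⟩
  simpa using hy r rfl (s - r)

section Conjugate

variable {g : E → ℝ}

lemma coe_le_conjugate (g : E → ℝ) (y s : E) :
    ((inner ℝ y s - g s : ℝ) : EReal) ≤ conjugate (fun x => (g x : EReal)) y := by
  rw [EReal.coe_sub]
  exact le_iSup (fun x => ((inner ℝ y x : ℝ) : EReal) - (g x : EReal)) s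

lemma conjugate_ne_bot (g : E → ℝ) (y : E) : conjugate (fun x => (g x : EReal)) y ≠ ⊥ :=
  ((EReal.bot_lt_coe _).trans_le (coe_le_conjugate g y 0)).ne'

lemma conjugate_le_coe {y : E} {a : ℝ} (h : ∀ s, inner ℝ y s - g s ≤ a) :
    conjugate (fun x => (g x : EReal)) y ≤ (a : EReal) :=
  iSup_le fun s => by rw [← EReal.coe_sub]; exact_mod_cast h s

lemma le_toReal_conjugate {y : E} (hy : y ∈ effDom (conjugate fun x => (g x : EReal))) (s : E) :
    inner ℝ y s - g s ≤ (conjugate (fun x => (g x : EReal)) y).toReal := by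
  have h := coe_le_conjugate g y s
  rw [← EReal.coe_toReal hy (conjugate_ne_bot g y)] at h
  exact_mod_cast h

lemma convexOn_conjugate (g : E → ℝ) :
    ConvexOn ℝ (effDom (conjugate fun x => (g x : EReal)))
      fun y => (conjugate (fun x => (g x : EReal)) y).toReal := by
  have key : ∀ x ∈ effDom (conjugate fun x => (g x : EReal)),
      ∀ y ∈ effDom (conjugate fun x => (g x : EReal)), ∀ a b : ℝ, 0 ≤ a → 0 ≤ b → a + b = 1 →
      conjugate (fun x => (g x : EReal)) (a • x + b • y) ≤
        ((a * (conjugate (fun x => (g x : EReal)) x).toReal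
          + b * (conjugate (fun x => (g x : EReal)) y).toReal : ℝ) : EReal) := by
    intro x hx y hy a b ha hb hab
    refine conjugate_le_coe fun s => ?_
    have h1 := mul_le_mul_of_nonneg_left (le_toReal_conjugate hx s) ha
    have h2 := mul_le_mul_of_nonneg_left (le_toReal_conjugate hy s) hb
    rw [inner_add_left, inner_smul_left, inner_smul_left]
    simp only [conj_trivial]
    have : g s = a * g s + b * g s := by rw [← add_mul, hab, one_mul]
    linarith
  refine ⟨fun x hx y hy a b ha hb hab => ?_, fun x hx y hy a b ha hb hab => ?_⟩
  · exact ((key x hx y hy a b ha hb hab).trans_lt (EReal.coe_lt_top _)).ne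
  · have h := key x hx y hy a b ha hb hab
    simpa only [smul_eq_mul] using toReal_le_of_le_coe h (conjugate_ne_bot g _)

/-- Moreau's identity: `u = prox_{ρ g*}(z)` is a subgradient of `g` at `(z - u) / ρ`. -/
lemma IsProx.subgradient_of_conjugate [CompleteSpace E] (hg : ConvexOn ℝ Set.univ g)
    (hgc : Continuous g) {ρ : ℝ} (hρ : 0 < ρ) {z u : E}
    (h : IsProx ρ (conjugate fun x => (g x : EReal)) z u) (s : E) :
    g (ρ⁻¹ • (z - u)) + inner ℝ u (s - ρ⁻¹ • (z - u)) ≤ g s := by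
  set r := ρ⁻¹ • (z - u) with hr
  -- A subgradient `y` at the candidate point serves as test point: `g*(y)` is known exactly there,
  -- and in the three-point inequality the terms `‖u - y‖²` cancel. What remains is `g*(u) ≤ ⟪u, r⟫
  -- - g r`, the equality case of Fenchel–Young; biconjugation is not needed.
  obtain ⟨y, hy⟩ := exists_subgradient hg hgc r
  have hyc : conjugate (fun x => (g x : EReal)) y ≤ ((inner ℝ y r - g r : ℝ) : EReal) :=
    conjugate_le_coe fun s => by have := hy s; rw [inner_sub_right] at this; linarith
  have hyd : y ∈ effDom (conjugate fun x => (g x : EReal)) :=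
    (hyc.trans_lt (EReal.coe_lt_top _)).ne
  have hyr : (conjugate (fun x => (g x : EReal)) y).toReal ≤ inner ℝ y r - g r :=
    toReal_le_of_le_coe hyc (conjugate_ne_bot g y)
  have hud := h.mem_effDom hρ (conjugate_ne_bot g) hyd
  have h3 := h.three_point hρ (conjugate_ne_bot g)
    (strongConvexOn_zero.2 (convexOn_conjugate g)) hyd
  have hz : u - z = -(ρ • r) := by
    rw [hr, smul_inv_smul₀ hρ.ne']; abel
  have hyz : y - z = (y - u) + -(ρ • r) := by rw [← hz]; abel
  rw [hyz, hz, norm_add_sq_real, norm_sub_rev u y, inner_neg_right, inner_smul_right,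
    inner_sub_left] at h3
  have h4 : ρ * ((conjugate (fun x => (g x : EReal)) u).toReal)
      ≤ ρ * (inner ℝ u r - g r) := by nlinarith
  have h5 := le_of_mul_le_mul_left h4 hρ
  have h6 := le_toReal_conjugate hud s
  rw [inner_sub_right]
  linarith

lemma IsProx.unique_of_conjugate [CompleteSpace E] (hg : ConvexOn ℝ Set.univ g)
    (hgc : Continuous g) {ρ : ℝ} (hρ : 0 < ρ) {z u u' : E}
    (h : IsProx ρ (conjugate fun x => (g x : EReal)) z u)
    (h' : IsProx ρ (conjugate fun x => (g x : EReal)) z u') : u = u' := by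
  obtain ⟨y, hy⟩ := exists_subgradient hg hgc 0
  refine h.unique hρ le_rfl (conjugate_ne_bot g) ⟨y, ?_⟩
    (strongConvexOn_zero.2 (convexOn_conjugate g)) h'
  have : conjugate (fun x => (g x : EReal)) y ≤ ((-g 0 : ℝ) : EReal) :=
    conjugate_le_coe fun s => by have := hy s; rw [sub_zero] at this; linarith
  exact (this.trans_lt (EReal.coe_lt_top _)).ne

end Conjugate

end ConvexTools

/-! ### Extended-real sums, block geometry and smoothness. -/

lemma ereal_sum_coe {ι : Type*} (s : Finset ι) (a : ι → ℝ) :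
    ∑ i ∈ s, (a i : EReal) = ((∑ i ∈ s, a i : ℝ) : EReal) := by
  induction s using Finset.cons_induction with
  | empty => simp
  | cons i s hi ih => rw [Finset.sum_cons, Finset.sum_cons, ih, EReal.coe_add]

lemma ereal_sum_ne_bot {ι : Type*} (s : Finset ι) {a : ι → EReal} (ha : ∀ i, a i ≠ ⊥) :
    ∑ i ∈ s, a i ≠ ⊥ := by
  induction s using Finset.cons_induction with
  | empty => simp
  | cons i s hi ih =>
    rw [Finset.sum_cons, Ne, EReal.add_eq_bot_iff]
    exact not_or.2 ⟨ha i, ih⟩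

lemma ereal_sum_eq_top {ι : Type*} [DecidableEq ι] {s : Finset ι} {a : ι → EReal}
    (ha : ∀ i, a i ≠ ⊥) {i : ι} (hi : i ∈ s) (h : a i = ⊤) : ∑ i ∈ s, a i = ⊤ := by
  rw [← Finset.add_sum_erase s a hi, h, EReal.top_add_of_ne_bot (ereal_sum_ne_bot _ ha)]

section Blocks

variable {n m : ℕ} {p : Fin n → ℕ} {d : Fin m → ℕ}

@[simp] lemma blockEmbed_same (j : Fin n) (t : EuclideanSpace ℝ (Fin (p j))) :
    blockEmbed j t j = t := by simp [blockEmbed]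

lemma blockEmbed_ne {i j : Fin n} (h : i ≠ j) (t : EuclideanSpace ℝ (Fin (p j))) :
    blockEmbed j t i = 0 := by simp [blockEmbed, Pi.single_eq_of_ne h]

lemma blockEmbed_smul (j : Fin n) (a : ℝ) (t : EuclideanSpace ℝ (Fin (p j))) :
    blockEmbed j (a • t) = a • blockEmbed j t := by
  ext i : 1
  by_cases h : i = j
  · subst h; simp
  · simp [blockEmbed_ne h]

lemma inner_blockEmbed (x : BlockSpace p) (j : Fin n) (t : EuclideanSpace ℝ (Fin (p j))) :
    inner ℝ x (blockEmbed j t) = inner ℝ (x j) t := by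
  rw [PiLp.inner_apply, Finset.sum_eq_single j]
  · rw [blockEmbed_same]
  · intro i _ hi; rw [blockEmbed_ne hi, inner_zero_right]
  · simp

lemma norm_blockEmbed (j : Fin n) (t : EuclideanSpace ℝ (Fin (p j))) :
    ‖(blockEmbed j t : BlockSpace p)‖ = ‖t‖ := by
  have h : ‖(blockEmbed j t : BlockSpace p)‖ ^ 2 = ‖t‖ ^ 2 := by
    rw [← real_inner_self_eq_norm_sq, inner_blockEmbed, blockEmbed_same,
      real_inner_self_eq_norm_sq]
  exact (sq_eq_sq₀ (norm_nonneg _) (norm_nonneg _)).1 h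

lemma sub_eq_blockEmbed {x y : BlockSpace p} {j : Fin n} (h : ∀ i, i ≠ j → x i = y i) :
    x - y = blockEmbed j (x j - y j) := by
  ext i : 1
  by_cases hi : i = j
  · subst hi; simp
  · simp [blockEmbed_ne hi, h i hi]

lemma sum_eq_add_block {F : Fin n → ℝ} {F' : Fin n → ℝ} {j : Fin n}
    (h : ∀ i, i ≠ j → F i = F' i) : ∑ i, F i = ∑ i, F' i + (F j - F' j) := by
  have : ∑ i, (F i - F' i) = F j - F' j :=
    Finset.sum_eq_single j (fun i _ hi => by rw [h i hi, sub_self]) (by simp)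
  rw [Finset.sum_sub_distrib] at this
  linarith

lemma blockDiag_apply (w : Fin n → ℝ) (x : BlockSpace p) (i : Fin n) :
    blockDiag p w x i = w i • x i := rfl

/-- Rescaling a single block by `√σ_j` cancels the factor `1/√σ_j` inside the operator whose norm
defines `L̄_σ`. -/
lemma Problem.norm_sq_K_blockEmbed_le (Q : Problem n m p d) {σ : Fin n → ℝ} (hσ : ∀ j, 0 < σ j)
    (j : Fin n) (t : EuclideanSpace ℝ (Fin (p j))) :
    ‖Q.K (blockEmbed j t)‖ ^ 2 ≤ Q.Lbar σ * (σ j * ‖t‖ ^ 2) := by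
  have hs := Real.sqrt_pos.2 (hσ j)
  have h1 : (blockEmbed j t : BlockSpace p)
      = blockDiag p (fun j => 1 / √(σ j)) (blockEmbed j (√(σ j) • t)) := by
    ext i : 1
    rw [blockDiag_apply]
    by_cases h : i = j
    · subst h
      rw [blockEmbed_same, blockEmbed_same, smul_smul, one_div_mul_cancel hs.ne', one_smul]
    · simp [blockEmbed_ne h]
  have h2 : ‖Q.K (blockEmbed j t)‖
      ≤ ‖Q.K.comp (blockDiag p fun j => 1 / √(σ j))‖ * (√(σ j) * ‖t‖) := by
    have h3 := (Q.K.comp (blockDiag p fun j => 1 / √(σ j))).le_opNorm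
      (blockEmbed j (√(σ j) • t))
    rw [norm_blockEmbed, norm_smul, Real.norm_of_nonneg hs.le] at h3
    nth_rewrite 1 [h1]
    exact h3
  calc ‖Q.K (blockEmbed j t)‖ ^ 2
      ≤ (‖Q.K.comp (blockDiag p fun j => 1 / √(σ j))‖ * (√(σ j) * ‖t‖)) ^ 2 := by gcongr
    _ = Q.Lbar σ * (σ j * ‖t‖ ^ 2) := by
      rw [mul_pow, mul_pow, Real.sq_sqrt (hσ j).le, Problem.Lbar]

/-- The descent lemma for a block-Lipschitz gradient. -/
lemma block_descent {h : BlockSpace p → ℝ} (hd : Differentiable ℝ h) {L : ℝ} {j : Fin n}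
    (hL : ∀ (x : BlockSpace p) (t : EuclideanSpace ℝ (Fin (p j))),
      ‖gradient h (x + blockEmbed j t) j - gradient h x j‖ ≤ L * ‖t‖)
    (x : BlockSpace p) (t : EuclideanSpace ℝ (Fin (p j))) :
    h (x + blockEmbed j t) ≤ h x + inner ℝ (gradient h x j) t + L / 2 * ‖t‖ ^ 2 := by
  -- Subtracting the claimed quadratic upper model along the segment leaves a function with
  -- nonpositive derivative on `(0, 1)`; its values at the end points are then compared.
  have hder : ∀ s : ℝ, HasDerivAt
      (fun s : ℝ => h (x + s • blockEmbed j t) - s * inner ℝ (gradient h x j) t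
        - s ^ 2 * (L / 2 * ‖t‖ ^ 2))
      (inner ℝ (gradient h (x + s • blockEmbed j t) j) t - 1 * inner ℝ (gradient h x j) t
        - (2 * s) * (L / 2 * ‖t‖ ^ 2)) s := by
    intro s
    have h1 : HasDerivAt (fun s : ℝ => x + s • (blockEmbed j t : BlockSpace p))
        (blockEmbed j t) s := by
      simpa using ((hasDerivAt_id s).smul_const (blockEmbed j t : BlockSpace p)).const_add x
    have h2 := (hd (x + s • blockEmbed j t)).hasGradientAt.hasFDerivAt.comp_hasDerivAt s h1
    rw [InnerProductSpace.toDual_apply_apply, inner_blockEmbed] at h2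
    refine (h2.sub ((hasDerivAt_id s).mul_const _)).sub ?_
    simpa using (hasDerivAt_pow 2 s).mul_const (L / 2 * ‖t‖ ^ 2)
  have hanti : AntitoneOn (fun s : ℝ => h (x + s • blockEmbed j t)
      - s * inner ℝ (gradient h x j) t - s ^ 2 * (L / 2 * ‖t‖ ^ 2)) (Set.Icc 0 1) := by
    refine antitoneOn_of_deriv_nonpos (convex_Icc 0 1)
      (fun s _ => (hder s).continuousAt.continuousWithinAt)
      (fun s _ => (hder s).differentiableAt.differentiableWithinAt) fun s hs => ?_
    rw [interior_Icc] at hs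
    rw [(hder s).deriv]
    have h1 : inner ℝ (gradient h (x + s • blockEmbed j t) j - gradient h x j) t
        ≤ L * ‖s • t‖ * ‖t‖ := by
      refine (real_inner_le_norm _ _).trans ?_
      have := hL x (s • t)
      rw [blockEmbed_smul] at this
      gcongr
    rw [inner_sub_left, norm_smul, Real.norm_of_nonneg hs.1.le] at h1
    nlinarith
  have := hanti (Set.left_mem_Icc.2 zero_le_one) (Set.right_mem_Icc.2 zero_le_one) zero_le_one
  simp only [one_smul, zero_smul, add_zero] at this
  linarith

/-- The gradient inequality of a differentiable convex function. -/
lemma gradient_inequality {E : Type*} [NormedAddCommGroup E] [InnerProductSpace ℝ E]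
    [CompleteSpace E] {h : E → ℝ} (hc : ConvexOn ℝ Set.univ h) (hd : Differentiable ℝ h)
    (x y : E) : h x + inner ℝ (gradient h x) (y - x) ≤ h y := by
  let ℓ : ℝ →ᵃ[ℝ] E := AffineMap.lineMap x y
  have hline : ∀ s : ℝ, ℓ s = x + s • (y - x) := fun s => by
    simp [ℓ, AffineMap.lineMap_apply, add_comm]
  have hconv : ConvexOn ℝ Set.univ (fun s : ℝ => h (x + s • (y - x))) := by
    have := hc.comp_affineMap ℓ
    rw [Set.preimage_univ] at this
    refine this.congr fun s _ => ?_
    simp [hline]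
  have h1 : HasDerivAt (fun s : ℝ => x + s • (y - x)) (y - x) 0 := by
    simpa using ((hasDerivAt_id (0 : ℝ)).smul_const (y - x)).const_add x
  have h2 := (hd (x + (0 : ℝ) • (y - x))).hasGradientAt.hasFDerivAt.comp_hasDerivAt 0 h1
  rw [InnerProductSpace.toDual_apply_apply, zero_smul, add_zero] at h2
  have h3 := hconv.le_slope_of_hasDerivAt (Set.mem_univ 0) (Set.mem_univ 1) zero_lt_one h2
  rw [slope_def_field] at h3
  simp only [one_smul, zero_smul, add_zero, sub_zero, div_one,
    add_sub_cancel] at h3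
  linarith

end Blocks

/-! ### The real-valued problem and strong duality. -/

namespace Problem

variable {n m : ℕ} {p : Fin n → ℕ} {d : Fin m → ℕ} (Q : Problem n m p d)

/-- The effective domain of `f`. -/
def dom : Set (BlockSpace p) := {x | ∀ j, x j ∈ effDom (Q.fj j)}

/-- The real-valued version of `f` on its domain. -/
def fR (x : BlockSpace p) : ℝ := ∑ j, (Q.fj j (x j)).toReal

/-- The real-valued version of a finite `g`. -/
def gR (y : BlockSpace d) : ℝ := (Q.g y).toReal

/-- The real-valued objective on the domain of `f`. -/
def FR (x : BlockSpace p) : ℝ := Q.fR x + Q.h x + Q.gR (Q.K x)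

variable {Q} {μ L : Fin n → ℝ} (hQ : Q.Assumptions μ L) {Mg : ℝ} (hg : IsLipschitzFun Mg Q.g)
include hQ

lemma f_eq_coe {x : BlockSpace p} (hx : x ∈ Q.dom) : Q.f x = (Q.fR x : EReal) := by
  rw [f, fR, ← ereal_sum_coe]
  exact Finset.sum_congr rfl fun j _ => (EReal.coe_toReal (hx j) ((hQ.fj_proper j).1 _)).symm

lemma f_eq_top {x : BlockSpace p} (hx : x ∉ Q.dom) : Q.f x = ⊤ := by
  simp only [dom, Set.mem_ofPred_eq, not_forall] at hx
  obtain ⟨j, hj⟩ := hx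
  exact ereal_sum_eq_top (fun i => (hQ.fj_proper i).1 _) (Finset.mem_univ j) (not_not.1 hj)

lemma g_ne_bot (y : BlockSpace d) : Q.g y ≠ ⊥ :=
  ereal_sum_ne_bot _ fun i => (hQ.gi_proper i).1 _

lemma convexOn_fR : ConvexOn ℝ Q.dom Q.fR := by
  have hj := fun j => convexOn_toReal (hQ.fj_proper j).1
  have hs := fun j => strongConvexOn_toReal (hQ.fj_proper j).1 (hQ.fj_strong j)
  have hc : ∀ j, ConvexOn ℝ (effDom (Q.fj j)) fun z => (Q.fj j z).toReal := fun j =>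
    strongConvexOn_zero.1 ((hs j).mono (hQ.μ_pos j).le)
  refine ⟨fun x hx y hy a b ha hb hab j => (hc j).1 (hx j) (hy j) ha hb hab,
    fun x hx y hy a b ha hb hab => ?_⟩
  simp only [fR, smul_eq_mul, Finset.mul_sum, ← Finset.sum_add_distrib]
  exact Finset.sum_le_sum fun j _ => (hc j).2 (hx j) (hy j) ha hb hab

include hg

lemma g_ne_top (y : BlockSpace d) : Q.g y ≠ ⊤ := by
  choose z hz using fun i => (hQ.gi_proper i).2
  have h0 : Q.g (WithLp.toLp 2 z) = ((∑ i, (Q.gi i (z i)).toReal : ℝ) : EReal) := by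
    rw [g, ← ereal_sum_coe]
    exact Finset.sum_congr rfl fun i _ => (EReal.coe_toReal (hz i) ((hQ.gi_proper i).1 _)).symm
  have h1 := hg.2 y (WithLp.toLp 2 z)
  rw [h0, ← EReal.coe_add] at h1
  exact (h1.trans_lt (EReal.coe_lt_top _)).ne

lemma g_eq_coe (y : BlockSpace d) : Q.g y = (Q.gR y : EReal) :=
  (EReal.coe_toReal (g_ne_top hQ hg y) (g_ne_bot hQ y)).symm

lemma g_eq : Q.g = fun y => (Q.gR y : EReal) := funext (g_eq_coe hQ hg)

lemma gR_le (x y : BlockSpace d) : Q.gR x ≤ Q.gR y + Mg * ‖x - y‖ := by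
  have h := hg.2 x y
  rw [g_eq_coe hQ hg, g_eq_coe hQ hg, ← EReal.coe_add] at h
  exact_mod_cast h

lemma continuous_gR : Continuous Q.gR := by
  refine (LipschitzWith.of_le_add_mul (Real.toNNReal Mg) fun x y => ?_).continuous
  rw [Real.coe_toNNReal _ hg.1, dist_eq_norm]
  exact gR_le hQ hg x y

lemma convexOn_gR : ConvexOn ℝ Set.univ Q.gR := by
  have hne : ∀ (y : BlockSpace d) i, y i ∈ effDom (Q.gi i) := fun y i hi =>
    g_ne_top hQ hg y (ereal_sum_eq_top (fun i => (hQ.gi_proper i).1 _) (Finset.mem_univ i) hi)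
  have hsum : ∀ y, Q.gR y = ∑ i, (Q.gi i (y i)).toReal := fun y => by
    rw [← EReal.coe_eq_coe_iff, ← g_eq_coe hQ hg, g, ← ereal_sum_coe]
    exact Finset.sum_congr rfl fun i _ =>
      (EReal.coe_toReal (hne y i) ((hQ.gi_proper i).1 _)).symm
  have hc := fun i => convexOn_toReal (hQ.gi_proper i).1 (hQ.gi_convex i)
  refine ⟨convex_univ, fun x _ y _ a b ha hb hab => ?_⟩
  simp only [hsum, smul_eq_mul, Finset.mul_sum, ← Finset.sum_add_distrib]
  exact Finset.sum_le_sum fun i _ => (hc i).2 (hne x i) (hne y i) ha hb hab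

lemma F_eq_coe {x : BlockSpace p} (hx : x ∈ Q.dom) : Q.F x = (Q.FR x : EReal) := by
  rw [F, phi, f_eq_coe hQ hx, g_eq_coe hQ hg, ← EReal.coe_add, ← EReal.coe_add]; rfl

lemma F_ne_top_iff {x : BlockSpace p} : Q.F x ≠ ⊤ ↔ x ∈ Q.dom := by
  refine ⟨fun h => by_contra fun hx => h ?_, fun hx => ?_⟩
  · rw [F, phi, f_eq_top hQ hx, g_eq_coe hQ hg, EReal.top_add_coe, EReal.top_add_coe]
  · rw [F_eq_coe hQ hg hx]; exact EReal.coe_ne_top _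

lemma IsPrimalSolution.mem_dom {xs x₀ : BlockSpace p} (hxs : Q.IsPrimalSolution xs)
    (hx₀ : x₀ ∈ Q.dom) : xs ∈ Q.dom := by
  rw [← F_ne_top_iff hQ hg]
  refine ((hxs x₀).trans_lt ?_).ne
  rw [F_eq_coe hQ hg hx₀]; exact EReal.coe_lt_top _

lemma IsPrimalSolution.FR_le {xs x : BlockSpace p} (hxs : Q.IsPrimalSolution xs)
    (hx : x ∈ Q.dom) : Q.FR xs ≤ Q.FR x := by
  have h := hxs x
  rw [F_eq_coe hQ hg hx, F_eq_coe hQ hg (hxs.mem_dom hQ hg hx)] at h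
  exact_mod_cast h

lemma IsPrimalSolution.Fstar_eq {xs x₀ : BlockSpace p} (hxs : Q.IsPrimalSolution xs)
    (hx₀ : x₀ ∈ Q.dom) : Q.Fstar.toReal = Q.FR xs := by
  have h : Q.Fstar = Q.F xs := le_antisymm (iInf_le _ xs) (le_iInf hxs)
  rw [h, F_eq_coe hQ hg (hxs.mem_dom hQ hg hx₀), EReal.toReal_coe]

omit hQ hg in
/-- `y` is a saddle-point multiplier for the constraint `K x = r` at the minimizer `xs`. -/
def IsMultiplier (Q : Problem n m p d) (xs : BlockSpace p) (y : BlockSpace d) : Prop :=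
  ∀ x ∈ Q.dom, ∀ r, Q.FR xs ≤ Q.fR x + Q.h x + Q.gR r + inner ℝ y (Q.K x - r)

lemma exists_isMultiplier {xs x₀ : BlockSpace p} (hxs : Q.IsPrimalSolution xs)
    (hx₀ : x₀ ∈ Q.dom) : ∃ y, Q.IsMultiplier xs y := by
  have hφ : ConvexOn ℝ Q.dom fun x => Q.fR x + Q.h x :=
    (convexOn_fR hQ).add (hQ.h_convex.subset (Set.subset_univ _) (convexOn_fR hQ).1)
  obtain ⟨y, hy⟩ := exists_multiplier Q.K hφ (convexOn_gR hQ hg) (continuous_gR hQ hg)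
    (hxs.mem_dom hQ hg hx₀) fun x hx => hxs.FR_le hQ hg hx
  refine ⟨y, fun x hx r => ?_⟩
  have h := hy x hx (r - Q.K x)
  rw [add_sub_cancel, ← neg_sub, inner_neg_right] at h
  rw [FR]
  linarith

/-- The supremum over `r` comes first: the feasible point `x₀` shows that `g*(y)` is finite. It can
then be treated as a real number while the supremum over `x` bounds `φ*(-Kᵀy)`. -/
lemma IsMultiplier.G_le {xs x₀ : BlockSpace p} {y : BlockSpace d}
    (hx₀ : x₀ ∈ Q.dom) (hy : Q.IsMultiplier xs y) :
    Q.G y ≤ ((-Q.FR xs : ℝ) : EReal) := by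
  rw [G, g_eq hQ hg]
  have h1 : conjugate (fun y => (Q.gR y : EReal)) y
      ≤ ((Q.fR x₀ + Q.h x₀ + inner ℝ y (Q.K x₀) - Q.FR xs : ℝ) : EReal) :=
    conjugate_le_coe fun r => by
      have := hy x₀ hx₀ r
      rw [inner_sub_right] at this
      linarith
  have hd : y ∈ effDom (conjugate fun y => (Q.gR y : EReal)) :=
    (h1.trans_lt (EReal.coe_lt_top _)).ne
  set b := (conjugate (fun y => (Q.gR y : EReal)) y).toReal with hb
  have hbe : conjugate (fun y => (Q.gR y : EReal)) y = (b : EReal) :=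
    (EReal.coe_toReal hd (conjugate_ne_bot _ _)).symm
  have h2 : conjugate Q.phi (-(ContinuousLinearMap.adjoint Q.K y))
      ≤ ((-Q.FR xs - b : ℝ) : EReal) := by
    refine iSup_le fun x => ?_
    by_cases hx : x ∈ Q.dom
    · have h3 : b ≤ Q.fR x + Q.h x + inner ℝ y (Q.K x) - Q.FR xs := by
        refine toReal_le_of_le_coe (conjugate_le_coe fun r => ?_) (conjugate_ne_bot _ _)
        have := hy x hx r
        rw [inner_sub_right] at this
        linarith
      rw [phi, f_eq_coe hQ hx, ← EReal.coe_add, ← EReal.coe_sub, inner_neg_left,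
        ContinuousLinearMap.adjoint_inner_left, EReal.coe_le_coe_iff]
      linarith
    · rw [phi, f_eq_top hQ hx, EReal.top_add_coe, EReal.sub_top]
      exact bot_le
  rw [hbe]
  calc _ ≤ ((-Q.FR xs - b : ℝ) : EReal) + (b : EReal) := add_le_add_left h2 _
    _ = _ := by rw [← EReal.coe_add, sub_add_cancel]

/-- Some multiplier has dual value at most `-F*`, hence so does every dual minimizer. Bounding both
conjugates in `G` below by their affine pieces at `x` and `r` recovers the multiplier inequality. -/
lemma IsDualSolution.isMultiplier {xs x₀ : BlockSpace p} {ys : BlockSpace d}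
    (hxs : Q.IsPrimalSolution xs) (hx₀ : x₀ ∈ Q.dom) (hys : Q.IsDualSolution ys) :
    Q.IsMultiplier xs ys := by
  obtain ⟨y, hy⟩ := exists_isMultiplier hQ hg hxs hx₀
  have hle := (hys y).trans (hy.G_le hQ hg hx₀)
  intro x hx r
  rw [G, g_eq hQ hg] at hle
  have h1 : ((inner ℝ (-(ContinuousLinearMap.adjoint Q.K ys)) x - (Q.fR x + Q.h x) : ℝ) : EReal)
      ≤ conjugate Q.phi (-(ContinuousLinearMap.adjoint Q.K ys)) := by
    have := le_iSup (fun x => ((inner ℝ (-(ContinuousLinearMap.adjoint Q.K ys)) x : ℝ) : EReal)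
      - Q.phi x) x
    rwa [phi, f_eq_coe hQ hx, ← EReal.coe_add, ← EReal.coe_sub] at this
  have h2 := (add_le_add h1 (coe_le_conjugate Q.gR ys r)).trans hle
  rw [← EReal.coe_add, EReal.coe_le_coe_iff, inner_neg_left,
    ContinuousLinearMap.adjoint_inner_left] at h2
  rw [inner_sub_right]
  linarith

end Problem

/-! ### One iteration: dual step, proximal block step, averaging over blocks. -/

/-- Change of the augmented Lagrangian and of the dual distance along one multiplier update. -/
lemma multiplier_update_le {H : Type*} [NormedAddCommGroup H] [InnerProductSpace ℝ H] {ρ : ℝ}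
    (hρ : 0 < ρ) (yh ys v e u : H) :
    inner ℝ ys (v + e) + ρ / 2 * ‖v + e‖ ^ 2
        + 1 / ρ * ‖yh + (ρ / 2) • (v + e - u) - ys‖ ^ 2
      ≤ 1 / ρ * ‖yh - ys‖ ^ 2 + ρ / 2 * ‖u‖ ^ 2 + inner ℝ ys u
        + inner ℝ (yh + ρ • v) (v - u) + inner ℝ (yh + ρ • v) e + ρ * ‖e‖ ^ 2 := by
  -- With the dual step exactly `ρ/2`, the two sides differ by a perfect square.
  have key : 1 / ρ * ‖yh - ys‖ ^ 2 + ρ / 2 * ‖u‖ ^ 2 + inner ℝ ys u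
        + inner ℝ (yh + ρ • v) (v - u) + inner ℝ (yh + ρ • v) e + ρ * ‖e‖ ^ 2
      - (inner ℝ ys (v + e) + ρ / 2 * ‖v + e‖ ^ 2
        + 1 / ρ * ‖yh + (ρ / 2) • (v + e - u) - ys‖ ^ 2) = ρ / 4 * ‖v - u - e‖ ^ 2 := by
    have e1 : yh + (ρ / 2) • (v + e - u) - ys = (yh - ys) + (ρ / 2) • (v + e - u) := by abel
    rw [e1, norm_add_sq_real (yh - ys), norm_smul, Real.norm_of_nonneg (by positivity : 0 ≤ ρ / 2),
      inner_smul_right]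
    simp only [mul_pow, ← real_inner_self_eq_norm_sq, inner_add_left, inner_add_right,
      inner_sub_left, inner_sub_right, inner_smul_left, conj_trivial]
    rw [real_inner_comm yh ys, real_inner_comm v u, real_inner_comm v e, real_inner_comm u e]
    field_simp
    ring
  have : 0 ≤ ρ / 4 * ‖v - u - e‖ ^ 2 := by positivity
  linarith

/-- The proximal block step compared with the point `(1 - a) x̃ + a x*`. -/
lemma IsProx.block_step {V : Type*} [NormedAddCommGroup V] [InnerProductSpace ℝ V]
    {γ μ a : ℝ} {f : V → EReal} {G xt xb xs : V} (hγ : 0 < γ) (hμ : 0 ≤ μ) (ha : 0 ≤ a)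
    (ha1 : a ≤ 1) (hbot : ∀ x, f x ≠ ⊥)
    (hf : StrongConvexOn (effDom f) μ fun x => (f x).toReal)
    (h : IsProx γ f (xt - γ • G) xb) (hxt : xt ∈ effDom f) (hxs : xs ∈ effDom f) :
    (f xb).toReal - (f xt).toReal + inner ℝ G (xb - xt) + γ⁻¹ / 2 * ‖xb - xt‖ ^ 2
      ≤ a * ((f xs).toReal - (f xt).toReal + inner ℝ G (xs - xt)
        + γ⁻¹ / 2 * (‖xt - xs‖ ^ 2 - ‖xb - xs‖ ^ 2) - μ / 2 * ‖xb - xs‖ ^ 2) := by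
  -- The comparison point lies only a fraction `a` of the way to `x*`. This makes the right side
  -- proportional to `a`, which later compensates for `τ₀` being possibly smaller than `1/n`.
  set z := (1 - a) • xt + a • xs with hz
  have hzd : z ∈ effDom f := hf.1 hxt hxs (sub_nonneg.2 ha1) ha (by ring)
  have h1 := h.three_point hγ hbot hf hzd
  have h2 := hf.2 hxt hxs (sub_nonneg.2 ha1) ha (by ring)
  rw [← hz] at h2
  simp only [smul_eq_mul] at h2
  have e1 : ‖xb - (xt - γ • G)‖ ^ 2
      = ‖xb - xt‖ ^ 2 + 2 * γ * inner ℝ G (xb - xt) + γ ^ 2 * ‖G‖ ^ 2 := by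
    rw [show xb - (xt - γ • G) = (xb - xt) + γ • G by abel, norm_add_sq_real, norm_smul,
      inner_smul_right, Real.norm_of_nonneg hγ.le, real_inner_comm]
    ring
  have e2 : ‖z - (xt - γ • G)‖ ^ 2
      = a ^ 2 * ‖xt - xs‖ ^ 2 + 2 * γ * a * inner ℝ G (xs - xt) + γ ^ 2 * ‖G‖ ^ 2 := by
    rw [show z - (xt - γ • G) = a • (xs - xt) + γ • G by rw [hz]; module, norm_add_sq_real,
      norm_smul, norm_smul, inner_smul_right, inner_smul_left, Real.norm_of_nonneg hγ.le,
      Real.norm_of_nonneg ha, real_inner_comm, norm_sub_rev xs xt]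
    simp only [conj_trivial]
    ring
  have e3 : ‖xb - z‖ ^ 2 = (1 - a) * ‖xb - xt‖ ^ 2 + a * ‖xb - xs‖ ^ 2
      - a * (1 - a) * ‖xt - xs‖ ^ 2 := by
    rw [show xb - z = (1 - a) • (xb - xt) + a • (xb - xs) by rw [hz]; module,
      show xt - xs = (xb - xs) - (xb - xt) by abel, norm_add_sq_real,
      norm_sub_sq_real (xb - xs) (xb - xt), norm_smul, norm_smul, inner_smul_right,
      inner_smul_left, Real.norm_of_nonneg ha, Real.norm_of_nonneg (sub_nonneg.2 ha1),
      real_inner_comm]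
    simp only [conj_trivial]
    ring
  rw [e1, e2, e3] at h1
  have h3 := mul_le_mul_of_nonneg_left h2 hγ.le
  have h4 : 0 ≤ (1 + γ * μ) / 2 * ((1 - a) * ‖xb - xt‖ ^ 2) :=
    mul_nonneg (by positivity) (mul_nonneg (sub_nonneg.2 ha1) (by positivity))
  refine le_of_mul_le_mul_left ?_ hγ
  have e4 : γ * ((f xb).toReal - (f xt).toReal + inner ℝ G (xb - xt) + γ⁻¹ / 2 * ‖xb - xt‖ ^ 2)
      = γ * ((f xb).toReal - (f xt).toReal + inner ℝ G (xb - xt)) + ‖xb - xt‖ ^ 2 / 2 := by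
    field_simp
  have e5 : γ * (a * ((f xs).toReal - (f xt).toReal + inner ℝ G (xs - xt)
        + γ⁻¹ / 2 * (‖xt - xs‖ ^ 2 - ‖xb - xs‖ ^ 2) - μ / 2 * ‖xb - xs‖ ^ 2))
      = a * (γ * ((f xs).toReal - (f xt).toReal + inner ℝ G (xs - xt))
        + (‖xt - xs‖ ^ 2 - ‖xb - xs‖ ^ 2) / 2 - γ * μ / 2 * ‖xb - xs‖ ^ 2) := by
    field_simp
  rw [e4, e5]
  nlinarith

variable {n m : ℕ} {p : Fin n → ℕ} {d : Fin m → ℕ}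

lemma wnormSq_eq_add_block {w : Fin n → ℝ} {x y z : BlockSpace p} {i : Fin n}
    (h : ∀ l, l ≠ i → x l = y l) :
    wnormSq w (x - z) = wnormSq w (y - z) + w i * (‖x i - z i‖ ^ 2 - ‖y i - z i‖ ^ 2) := by
  rw [wnormSq, wnormSq, sum_eq_add_block (F' := fun j => w j * ‖(y - z) j‖ ^ 2) (j := i)]
  · simp only [PiLp.sub_apply]; ring
  · intro l hl; simp only [PiLp.sub_apply, h l hl]

namespace Problem

/-- The Lagrangian gap with `f(x)` replaced by the upper bound `fb`. -/
def gap (Q : Problem n m p d) (xs : BlockSpace p) (ys : BlockSpace d) (fb : ℝ) (x : BlockSpace p)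
    (r : BlockSpace d) : ℝ :=
  fb + Q.h x + Q.gR r + inner ℝ ys (Q.K x - r) - Q.FR xs

variable {Q : Problem n m p d} {μ L : Fin n → ℝ} (hQ : Q.Assumptions μ L)
include hQ

/-- The effect of one iteration of the algorithm on the Lyapunov terms when block `i` is drawn. -/
lemma block_iteration_le {σ : Fin n → ℝ} (hσ : ∀ j, 0 < σ j)
    {τ t0 ρ : ℝ} (hτ : 0 < τ) (ht0 : 0 < t0) (hnt : n * t0 ≤ 1) (hρ : 0 < ρ)
    (hκ : 0 < 2 * Q.Lbar σ * ρ + Lh L σ)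
    {xt xh xs : BlockSpace p} {yh y rp u ys : BlockSpace d} (hxt : xt ∈ Q.dom)
    (hxs : xs ∈ Q.dom) (hy : y = yh + ρ • (Q.K xh - rp)) (fb : ℝ) (i : Fin n) {X : BlockSpace p}
    (hkeep : ∀ l, l ≠ i → X l = xt l)
    (hprox : IsProx (t0 * (1 / (2 * Q.Lbar σ * ρ + Lh L σ)) / (σ i * τ)) (Q.fj i)
      (xt i - (t0 * (1 / (2 * Q.Lbar σ * ρ + Lh L σ)) / (σ i * τ)) •
        (gradient Q.h xh i + ContinuousLinearMap.adjoint Q.K y i)) (X i)) :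
    Q.gap xs ys (fb + τ / t0 * (Q.fR X - Q.fR xt)) (xh + (τ / t0) • (X - xt)) rp
        + ρ / 2 * ‖Q.K (xh + (τ / t0) • (X - xt)) - rp‖ ^ 2
        + 1 / ρ * ‖yh + (ρ / 2) • (Q.K (xh + (τ / t0) • (X - xt)) - rp - u) - ys‖ ^ 2
        + τ * (τ / t0 * (2 * Q.Lbar σ * ρ + Lh L σ) / 2 + muF μ σ / 2)
          * wnormSq (fun j => n * σ j) (X - xs)
      ≤ fb + Q.h xh + Q.gR rp - Q.FR xs + 1 / ρ * ‖yh - ys‖ ^ 2 + ρ / 2 * ‖u‖ ^ 2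
        + inner ℝ ys u + inner ℝ y (Q.K xh - rp - u)
        + τ * (τ / t0 * (2 * Q.Lbar σ * ρ + Lh L σ) / 2 + muF μ σ / 2)
          * wnormSq (fun j => n * σ j) (xt - xs)
        + n * τ * ((Q.fj i (xs i)).toReal - (Q.fj i (xt i)).toReal
          + inner ℝ ((gradient Q.h xh + ContinuousLinearMap.adjoint Q.K y) i) (xs i - xt i)
          - muF μ σ / 2 * (σ i * ‖xt i - xs i‖ ^ 2)) := by
  set κ := 2 * Q.Lbar σ * ρ + Lh L σ with hκdef
  set θ := τ / t0 with hθ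
  set G := (gradient Q.h xh + ContinuousLinearMap.adjoint Q.K y) i with hG
  have hθ0 : 0 < θ := div_pos hτ ht0
  have hσi := hσ i
  have hγ : 0 < t0 * (1 / κ) / (σ i * τ) := by positivity
  have hγi : (t0 * (1 / κ) / (σ i * τ))⁻¹ = σ i * (θ * κ) := by rw [hθ]; field_simp
  -- With `a = n τ₀` and the extrapolation factor `τ/τ₀`, the progress is weighted by `n τ`, hence
  -- by `τ` after averaging over `n` blocks.
  have hstep := hprox.block_step (a := n * t0) hγ (hQ.μ_pos i).le (by positivity) hnt
    (hQ.fj_proper i).1 (strongConvexOn_toReal (hQ.fj_proper i).1 (hQ.fj_strong i)) (hxt i) (hxs i)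
  rw [hγi] at hstep
  change (Q.fj i (X i)).toReal - (Q.fj i (xt i)).toReal + inner ℝ G (X i - xt i)
    + σ i * (θ * κ) / 2 * ‖X i - xt i‖ ^ 2 ≤ n * t0 * ((Q.fj i (xs i)).toReal
      - (Q.fj i (xt i)).toReal + inner ℝ G (xs i - xt i) + σ i * (θ * κ) / 2
      * (‖xt i - xs i‖ ^ 2 - ‖X i - xs i‖ ^ 2) - μ i / 2 * ‖X i - xs i‖ ^ 2) at hstep
  have hX : X - xt = blockEmbed i (X i - xt i) := sub_eq_blockEmbed hkeep
  have hinc : θ • (X - xt) = blockEmbed i (θ • (X i - xt i)) := by rw [blockEmbed_smul, ← hX]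
  set e := Q.K (θ • (X - xt)) with he
  have hKx : Q.K (xh + θ • (X - xt)) - rp = (Q.K xh - rp) + e := by rw [map_add]; abel
  have hdual := multiplier_update_le hρ yh ys (Q.K xh - rp) e u
  rw [← hy] at hdual
  have hLh : L i ≤ Lh L σ * σ i := by
    rw [← div_le_iff₀ hσi]
    exact le_ciSup (f := fun j => L j / σ j) (Set.finite_range _).bddAbove i
  have hmu : muF μ σ * σ i ≤ μ i := by
    rw [← le_div_iff₀ hσi]
    exact ciInf_le (f := fun j => μ j / σ j) (Set.finite_range _).bddBelow i
  have hdesc : Q.h (xh + θ • (X - xt)) ≤ Q.h xh + θ * inner ℝ (gradient Q.h xh i) (X i - xt i)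
      + Lh L σ / 2 * (θ ^ 2 * (σ i * ‖X i - xt i‖ ^ 2)) := by
    have h1 := block_descent hQ.h_diff (hQ.h_smooth i) xh (θ • (X i - xt i))
    rw [← hinc, inner_smul_right, norm_smul, Real.norm_of_nonneg hθ0.le] at h1
    have h2 := mul_le_mul_of_nonneg_right hLh (by positivity : 0 ≤ (θ * ‖X i - xt i‖) ^ 2 / 2)
    linarith
  have hee : ‖e‖ ^ 2 ≤ Q.Lbar σ * (θ ^ 2 * (σ i * ‖X i - xt i‖ ^ 2)) := by
    have h1 := Q.norm_sq_K_blockEmbed_le hσ i (θ • (X i - xt i))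
    rw [← hinc, norm_smul, Real.norm_of_nonneg hθ0.le] at h1
    linarith
  have hye : inner ℝ y e = θ * inner ℝ (ContinuousLinearMap.adjoint Q.K y i) (X i - xt i) := by
    rw [he, ← ContinuousLinearMap.adjoint_inner_left, hinc, inner_blockEmbed, inner_smul_right]
  have hGX : inner ℝ G (X i - xt i) = inner ℝ (gradient Q.h xh i) (X i - xt i)
      + inner ℝ (ContinuousLinearMap.adjoint Q.K y i) (X i - xt i) := by
    rw [hG, PiLp.add_apply, inner_add_left]
  have hfR : Q.fR X = Q.fR xt + ((Q.fj i (X i)).toReal - (Q.fj i (xt i)).toReal) :=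
    sum_eq_add_block (F := fun j => (Q.fj j (X j)).toReal)
      (F' := fun j => (Q.fj j (xt j)).toReal) fun l hl => by simp only [hkeep l hl]
  have hN := wnormSq_eq_add_block (w := fun j => n * σ j) (z := xs) hkeep
  have hstep' := mul_le_mul_of_nonneg_left hstep hθ0.le
  have hθt : θ * t0 = τ := by rw [hθ]; field_simp
  have hee' := mul_le_mul_of_nonneg_left hee hρ.le
  have hmu' := mul_le_mul_of_nonneg_right hmu
    (by positivity : 0 ≤ n * τ / 2 * ‖X i - xs i‖ ^ 2)
  rw [gap, hKx, hfR, hN]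
  have e1 : θ * (n * t0 * ((Q.fj i (xs i)).toReal
      - (Q.fj i (xt i)).toReal + inner ℝ G (xs i - xt i) + σ i * (θ * κ) / 2
      * (‖xt i - xs i‖ ^ 2 - ‖X i - xs i‖ ^ 2) - μ i / 2 * ‖X i - xs i‖ ^ 2))
      = n * τ * ((Q.fj i (xs i)).toReal
      - (Q.fj i (xt i)).toReal + inner ℝ G (xs i - xt i) + σ i * (θ * κ) / 2
      * (‖xt i - xs i‖ ^ 2 - ‖X i - xs i‖ ^ 2) - μ i / 2 * ‖X i - xs i‖ ^ 2) := by
    rw [← hθt]; ring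
  rw [e1, hGX] at hstep'
  -- This fixes the step size: the proximal quadratic splits exactly into the descent-lemma error of
  -- `h` and the cost `ρ ‖e‖²` of the dual step.
  have e2 : θ * (σ i * (θ * κ) / 2 * ‖X i - xt i‖ ^ 2)
      = Lh L σ / 2 * (θ ^ 2 * (σ i * ‖X i - xt i‖ ^ 2))
        + ρ * (Q.Lbar σ * (θ ^ 2 * (σ i * ‖X i - xt i‖ ^ 2))) := by rw [hκdef]; ring
  rw [mul_add θ, e2] at hstep'
  linarith

/-- Average over the drawn block of one iteration of the algorithm. -/
lemma average_iteration_le [NeZero n] {σ : Fin n → ℝ} (hσ : ∀ j, 0 < σ j)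
    {τ t0 ρ : ℝ} (hτ : 0 < τ) (hτ1 : τ ≤ 1) (ht0 : 0 < t0) (hnt : n * t0 ≤ 1) (hρ : 0 < ρ)
    (hκ : 0 < 2 * Q.Lbar σ * ρ + Lh L σ)
    {x xt xh xs : BlockSpace p} {yh y r rp ys : BlockSpace d} (hxt : xt ∈ Q.dom)
    (hxs : xs ∈ Q.dom) (hxh : xh = (1 - τ) • x + τ • xt) (hy : y = yh + ρ • (Q.K xh - rp))
    (hsub : ∀ s, Q.gR rp + inner ℝ y (s - rp) ≤ Q.gR s) (fb : ℝ)
    {X : Fin n → BlockSpace p} (hkeep : ∀ i l, l ≠ i → X i l = xt l)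
    (hprox : ∀ i, IsProx (t0 * (1 / (2 * Q.Lbar σ * ρ + Lh L σ)) / (σ i * τ)) (Q.fj i)
      (xt i - (t0 * (1 / (2 * Q.Lbar σ * ρ + Lh L σ)) / (σ i * τ)) •
        (gradient Q.h xh i + ContinuousLinearMap.adjoint Q.K y i)) (X i i)) :
    1 / n * ∑ i, (Q.gap xs ys ((1 - τ) * fb + τ * Q.fR xt + τ / t0 * (Q.fR (X i) - Q.fR xt))
          (xh + (τ / t0) • (X i - xt)) rp
        + ρ / 2 * ‖Q.K (xh + (τ / t0) • (X i - xt)) - rp‖ ^ 2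
        + 1 / ρ * ‖yh + (ρ / 2) • (Q.K (xh + (τ / t0) • (X i - xt)) - rp
          - (1 - τ) • (Q.K x - r)) - ys‖ ^ 2
        + τ * (τ / t0 * (2 * Q.Lbar σ * ρ + Lh L σ) / 2 + muF μ σ / 2)
          * wnormSq (fun j => n * σ j) (X i - xs))
      ≤ (1 - τ) * Q.gap xs ys fb x r + ρ / 2 * ((1 - τ) ^ 2 * ‖Q.K x - r‖ ^ 2)
        + 1 / ρ * ‖yh - ys‖ ^ 2
        + τ * (τ / t0 * (2 * Q.Lbar σ * ρ + Lh L σ) / 2 + muF μ σ / 2 * (1 - 1 / n))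
          * wnormSq (fun j => n * σ j) (xt - xs) := by
  have hn : (0 : ℝ) < n := Nat.cast_pos.2 (NeZero.pos n)
  set N := wnormSq (fun j => n * σ j) (xt - xs) with hN
  set u := (1 - τ) • (Q.K x - r) with hu
  set c1 := τ * (τ / t0 * (2 * Q.Lbar σ * ρ + Lh L σ) / 2 + muF μ σ / 2) with hc1
  -- `C` collects what does not depend on the drawn block, so the average acts only on the blockwise
  -- terms. These include the strong convexity gain, of which a share `1/n` remains.
  set C := ((1 - τ) * fb + τ * Q.fR xt) + Q.h xh + Q.gR rp - Q.FR xs + 1 / ρ * ‖yh - ys‖ ^ 2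
    + ρ / 2 * ‖u‖ ^ 2 + inner ℝ ys u + inner ℝ y (Q.K xh - rp - u) + c1 * N with hC
  set G := gradient Q.h xh + ContinuousLinearMap.adjoint Q.K y with hG
  have hsum := Finset.sum_le_sum fun i (_ : i ∈ Finset.univ) =>
    block_iteration_le hQ hσ hτ ht0 hnt hρ hκ (u := u) (ys := ys) hxt hxs hy
      ((1 - τ) * fb + τ * Q.fR xt) i (hkeep i) (hprox i)
  have hR : ∑ i, (C + n * τ * ((Q.fj i (xs i)).toReal - (Q.fj i (xt i)).toReal
      + inner ℝ (G i) (xs i - xt i) - muF μ σ / 2 * (σ i * ‖xt i - xs i‖ ^ 2)))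
      = n * C + n * τ * ∑ i, ((Q.fj i (xs i)).toReal - (Q.fj i (xt i)).toReal
      + inner ℝ (G i) (xs i - xt i) - muF μ σ / 2 * (σ i * ‖xt i - xs i‖ ^ 2)) := by
    rw [Finset.sum_add_distrib, Finset.sum_const, Finset.card_univ, Fintype.card_fin,
      nsmul_eq_mul, ← Finset.mul_sum]
  replace hsum := hsum.trans_eq hR
  have hlin : ∑ i, ((Q.fj i (xs i)).toReal - (Q.fj i (xt i)).toReal
      + inner ℝ (G i) (xs i - xt i) - muF μ σ / 2 * (σ i * ‖xt i - xs i‖ ^ 2))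
      = Q.fR xs - Q.fR xt + inner ℝ G (xs - xt) - muF μ σ / 2 * (1 / n * N) := by
    rw [Finset.sum_sub_distrib, Finset.sum_add_distrib, Finset.sum_sub_distrib,
      ← Finset.mul_sum, PiLp.inner_apply, hN, wnormSq, Finset.mul_sum]
    have hS : ∀ i, σ i * ‖xt i - xs i‖ ^ 2
        = 1 / (n : ℝ) * (n * σ i * ‖(xt - xs) i‖ ^ 2) := fun i => by
      rw [PiLp.sub_apply]; field_simp
    simp only [hS, fR, PiLp.sub_apply, Finset.mul_sum]
  rw [hlin] at hsum
  have havg := mul_le_mul_of_nonneg_left hsum (by positivity : (0 : ℝ) ≤ 1 / n)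
  refine havg.trans ?_
  have e0 : 1 / (n : ℝ) * (n * C + n * τ * (Q.fR xs - Q.fR xt + inner ℝ G (xs - xt)
      - muF μ σ / 2 * (1 / n * N))) = C + τ * (Q.fR xs - Q.fR xt + inner ℝ G (xs - xt)
      - muF μ σ / 2 * (1 / n * N)) := by
    field_simp
  refine e0.le.trans ?_
  -- Linearizations at `x̂` and `r⁺` are compared with the old pair `(x, r)` with weight `1 - τ` and
  -- with `(x*, K x*)` with weight `τ`. Since `x̂ = (1 - τ) x + τ x̃`, all the inner products
  -- cancel.
  have hh1 := mul_le_mul_of_nonneg_left (gradient_inequality hQ.h_convex hQ.h_diff xh x)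
    (sub_nonneg.2 hτ1)
  have hh2 := mul_le_mul_of_nonneg_left (gradient_inequality hQ.h_convex hQ.h_diff xh xs) hτ.le
  have hg1 := mul_le_mul_of_nonneg_left (hsub r) (sub_nonneg.2 hτ1)
  have hg2 := mul_le_mul_of_nonneg_left (hsub (Q.K xs)) hτ.le
  have hun : ‖u‖ ^ 2 = (1 - τ) ^ 2 * ‖Q.K x - r‖ ^ 2 := by
    rw [hu, norm_smul, mul_pow, Real.norm_eq_abs, sq_abs]
  have hGi : inner ℝ G (xs - xt) = inner ℝ (gradient Q.h xh) xs - inner ℝ (gradient Q.h xh) xt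
      + (inner ℝ y (Q.K xs) - inner ℝ y (Q.K xt)) := by
    rw [hG, inner_add_left, inner_sub_right, ContinuousLinearMap.adjoint_inner_left, map_sub,
      inner_sub_right]
  have hgxh : inner ℝ (gradient Q.h xh) xh = (1 - τ) * inner ℝ (gradient Q.h xh) x
      + τ * inner ℝ (gradient Q.h xh) xt := by
    have hz : ∀ z, inner ℝ z xh = (1 - τ) * inner ℝ z x + τ * inner ℝ z xt := fun z => by
      rw [hxh, inner_add_right, inner_smul_right, inner_smul_right]
    exact hz _
  have hyxh : inner ℝ y (Q.K xh) = (1 - τ) * inner ℝ y (Q.K x) + τ * inner ℝ y (Q.K xt) := by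
    rw [hxh, map_add, map_smul, map_smul, inner_add_right, inner_smul_right, inner_smul_right]
  have hyu : inner ℝ y u = (1 - τ) * (inner ℝ y (Q.K x) - inner ℝ y r) := by
    rw [hu, inner_smul_right, inner_sub_right]
  have hysu : inner ℝ ys u = (1 - τ) * inner ℝ ys (Q.K x - r) := by
    rw [hu, inner_smul_right]
  rw [inner_sub_right] at hh1 hh2 hg1 hg2
  rw [hC, hc1, hGi, hun, hysu, inner_sub_right y, inner_sub_right y, hyu, hyxh, gap]
  have hF : Q.FR xs = Q.fR xs + Q.h xs + Q.gR (Q.K xs) := rfl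
  rw [hgxh] at hh1 hh2
  rw [hF]
  linarith

end Problem

/-! ### Expectations of functions of finitely many uniform draws. -/

section RandomWords

variable {Ω : Type*} {n : ℕ} (j : ℕ → Ω → Fin n)

/-- Two outcomes share the first `k` draws. -/
def SamePast (k : ℕ) (ω ω' : Ω) : Prop := ∀ i < k, j i ω = j i ω'

/-- The word of the first `k` draws. -/
def word (k : ℕ) (ω : Ω) : Fin k → Fin n := fun i => j i ω

/-- A quantity determined by the first `k` draws. -/
def DependsOnPast (k : ℕ) {α : Type*} (A : Ω → α) : Prop :=
  ∀ ω ω', SamePast j k ω ω' → A ω = A ω'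

variable {j}

lemma samePast_of_word_eq {k : ℕ} {ω ω' : Ω} (h : word j k ω = word j k ω') :
    SamePast j k ω ω' := fun i hi => congrFun h ⟨i, hi⟩

variable [MeasurableSpace Ω] {P : Measure Ω} [IsProbabilityMeasure P]

lemma measurable_word (hjm : ∀ k, Measurable (j k)) (k : ℕ) : Measurable (word j k) :=
  measurable_pi_lambda _ fun i => hjm i

variable (hjm : ∀ k, Measurable (j k)) (hji : iIndepFun j P)
  (hjq : ∀ k i, P {ω | j k ω = i} = ENNReal.ofReal (1 / (n : ℝ)))

include hji hjq

lemma measure_word_eq (k : ℕ) (w : Fin k → Fin n) :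
    P (word j k ⁻¹' {w}) = ENNReal.ofReal ((1 / (n : ℝ)) ^ k) := by
  rcases k.eq_zero_or_pos with rfl | hk
  · have : word j 0 ⁻¹' {w} = Set.univ := by
      ext ω; simp only [Set.mem_preimage, Set.mem_singleton_iff, Set.mem_univ, iff_true]
      exact Subsingleton.elim _ _
    rw [this]; simp
  have h := hji.measure_inter_preimage_eq_mul (Finset.range k)
    (sets := fun i => if hi : i < k then {w ⟨i, hi⟩} else Set.univ) fun i _ =>
      MeasurableSet.of_discrete
  have hset : word j k ⁻¹' {w} = ⋂ i ∈ Finset.range k,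
      j i ⁻¹' (if hi : i < k then {w ⟨i, hi⟩} else Set.univ) := by
    ext ω
    simp only [Set.mem_preimage, Set.mem_singleton_iff, Set.mem_iInter, Finset.mem_range]
    refine ⟨fun hω i hi => ?_, fun hω => funext fun i => ?_⟩
    · rw [dif_pos hi, ← hω]; rfl
    · have := hω i i.2
      rw [dif_pos i.2] at this
      exact this
  rw [hset, h, Finset.prod_congr rfl (g := fun _ => ENNReal.ofReal (1 / (n : ℝ)))]
  · rw [Finset.prod_const, Finset.card_range, ENNReal.ofReal_pow (by positivity)]
  · intro i hi
    rw [dif_pos (Finset.mem_range.1 hi)]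
    exact hjq i _

/-- Every word has positive probability, so some outcome realizes it. Such representatives replace
conditional expectations. -/
lemma word_surjective [NeZero n] (k : ℕ) : Function.Surjective (word j k) := by
  intro w
  have h : P (word j k ⁻¹' {w}) ≠ 0 := by
    rw [measure_word_eq hji hjq]
    have : (0 : ℝ) < n := Nat.cast_pos.2 (NeZero.pos n)
    simp only [ne_eq, ENNReal.ofReal_eq_zero, not_le]
    positivity
  exact nonempty_of_measure_ne_zero h

include hjm

/-- No measurability of `A` is assumed: it factors through the word of draws, which is measurable
with values in a finite discrete space. -/
lemma DependsOnPast.integrable_and_integral [NeZero n] {k : ℕ} {A : Ω → ℝ}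
    (hA : DependsOnPast j k A) {sel : (Fin k → Fin n) → Ω} (hsel : ∀ w, word j k (sel w) = w) :
    Integrable A P ∧ ∫ ω, A ω ∂P = (1 / (n : ℝ)) ^ k * ∑ w, A (sel w) := by
  have hfac : A = (fun w => A (sel w)) ∘ word j k := by
    funext ω
    exact hA _ _ (samePast_of_word_eq (hsel _).symm)
  have hm := measurable_word hjm k
  have : IsProbabilityMeasure (P.map (word j k)) :=
    Measure.isProbabilityMeasure_map hm.aemeasurable
  have hi : Integrable (fun w => A (sel w)) (P.map (word j k)) := Integrable.of_finite
  refine ⟨?_, ?_⟩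
  · rw [hfac]; exact hi.comp_measurable hm
  · have h1 : ∫ ω, A ω ∂P = ∫ w, A (sel w) ∂(P.map (word j k)) := by
      rw [integral_map hm.aemeasurable hi.aestronglyMeasurable]
      exact integral_congr_ae (Eventually.of_forall fun ω => congrFun hfac ω)
    rw [h1, integral_fintype hi, Finset.mul_sum]
    refine Finset.sum_congr rfl fun w _ => ?_
    rw [smul_eq_mul, measureReal_def, Measure.map_apply hm (measurableSet_singleton w),
      measure_word_eq hji hjq, ENNReal.toReal_ofReal (by positivity)]

lemma DependsOnPast.integrable [NeZero n] {k : ℕ} {A : Ω → ℝ} (hA : DependsOnPast j k A) :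
    Integrable A P := by
  choose sel hsel using word_surjective hji hjq k
  exact (hA.integrable_and_integral hjm hji hjq hsel).1

/-- One-step conditional averaging: if averaging `A` over draw `k` is at most `B`, then so are the
expectations. -/
lemma DependsOnPast.integral_le [NeZero n] {k : ℕ} {A B : Ω → ℝ}
    (hA : DependsOnPast j (k + 1) A) (hB : DependsOnPast j k B)
    (h : ∀ ω (ω' : Fin n → Ω), (∀ i, SamePast j k ω (ω' i)) → (∀ i, j k (ω' i) = i) →
      1 / (n : ℝ) * ∑ i, A (ω' i) ≤ B ω) : ∫ ω, A ω ∂P ≤ ∫ ω, B ω ∂P := by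
  choose sel hsel using word_surjective hji hjq k
  choose sel' hsel' using word_surjective hji hjq (k + 1)
  rw [(hA.integrable_and_integral hjm hji hjq hsel').2,
    (hB.integrable_and_integral hjm hji hjq hsel).2]
  -- A word of length `k + 1` is a word of length `k` followed by one letter; the inner sum is the
  -- conditional average over draw `k`.
  have hsum : ∑ w, A (sel' w) = ∑ w : Fin k → Fin n, ∑ i, A (sel' (Fin.snoc w i)) := by
    rw [← Fintype.sum_equiv (Fin.snocEquiv fun _ : Fin (k + 1) => Fin n)
      (fun z => A (sel' (Fin.snoc z.2 z.1))) (fun w => A (sel' w)) fun _ => rfl,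
      Fintype.sum_prod_type, Finset.sum_comm]
  rw [hsum, pow_succ, mul_assoc, Finset.mul_sum]
  refine mul_le_mul_of_nonneg_left (Finset.sum_le_sum fun w _ => ?_) (by positivity)
  refine h (sel w) (fun i => sel' (Fin.snoc w i)) (fun i => ?_) fun i => ?_
  · intro l hl
    have h1 := congrFun (hsel w) ⟨l, hl⟩
    have h2 := congrFun (hsel' (Fin.snoc w i)) (Fin.castSucc ⟨l, hl⟩)
    rw [Fin.snoc_castSucc] at h2
    exact h1.trans h2.symm
  · have h2 := congrFun (hsel' (Fin.snoc w i)) (Fin.last k)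
    rw [Fin.snoc_last] at h2
    exact h2

end RandomWords

/-! ### Parameter identities and the structure of a single run. -/

/-- The scale `(k + c - 1) / c`, which is `τ₀ / τ_{k-1}`. -/
def scale (c : ℝ) (k : ℕ) : ℝ := (k + c - 1) / c

lemma scale_succ (c : ℝ) (k : ℕ) : scale c (k + 1) = (k + c) / c := by
  rw [scale]; push_cast; ring

lemma scale_succ_eq_add {c : ℝ} (k : ℕ) : scale c (k + 1) = scale c k + 1 / c := by
  rw [scale, scale]; push_cast; ring

lemma scale_pos {c : ℝ} (hc : 2 < c) (k : ℕ) : 0 < scale c k := by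
  have : (0 : ℝ) ≤ k := k.cast_nonneg
  exact div_pos (by linarith) (by linarith)

lemma one_le_scale_succ {c : ℝ} (hc : 2 < c) (k : ℕ) : 1 ≤ scale c (k + 1) := by
  have : (0 : ℝ) ≤ k := k.cast_nonneg
  rw [scale_succ, one_le_div (by linarith)]
  linarith

section ParamRule

variable {c t0 ρ0 Lb Lσ : ℝ} (hc : 2 < c) (ht0 : 0 < t0) (k : ℕ)
include hc

lemma paramRule_τ : (paramRule c t0 ρ0 Lb Lσ).τ k = t0 / scale c (k + 1) := by
  have : (0 : ℝ) ≤ k := k.cast_nonneg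
  rw [scale_succ]
  change c * t0 / (k + c) = _
  have : (k : ℝ) + c ≠ 0 := by linarith
  have : c ≠ 0 := by linarith
  field_simp

include ht0 in
lemma paramRule_ρ : (paramRule c t0 ρ0 Lb Lσ).ρ k = ρ0 * scale c (k + 1) ^ 2 := by
  have : (0 : ℝ) ≤ k := k.cast_nonneg
  rw [scale_succ]
  change ρ0 * t0 ^ 2 / (c * t0 / (k + c)) ^ 2 = _
  have : (k : ℝ) + c ≠ 0 := by linarith
  have : c ≠ 0 := by linarith
  field_simp

omit hc in
lemma paramRule_η : (paramRule c t0 ρ0 Lb Lσ).η k = (paramRule c t0 ρ0 Lb Lσ).ρ k / 2 := rfl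

omit hc in
lemma paramRule_β : (paramRule c t0 ρ0 Lb Lσ).β k
    = 1 / (2 * Lb * (paramRule c t0 ρ0 Lb Lσ).ρ k + Lσ) := rfl

end ParamRule

variable {n m : ℕ} {p : Fin n → ℕ} {d : Fin m → ℕ}

/-- The point `r^{k+1}` at which `y^{k+1}` is a subgradient of `g`. -/
def dualPoint (Q : Problem n m p d) (A : Params) (S : Iterates p d) : ℕ → BlockSpace d
  | 0 => Q.K (S.x 0)
  | k + 1 => (A.ρ k)⁻¹ • (S.yh k + A.ρ k • Q.K (S.xh k) - S.y (k + 1))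

/-- The residual `K x^k - r^k`. -/
def residual (Q : Problem n m p d) (A : Params) (S : Iterates p d) (k : ℕ) : BlockSpace d :=
  Q.K (S.x k) - dualPoint Q A S k

/-- The average of the values `f(x̃^l)` with the weights by which `x^k` averages the `x̃^l`. -/
def averagedF (Q : Problem n m p d) (t0 : ℝ) (A : Params) (S : Iterates p d) : ℕ → ℝ
  | 0 => Q.fR (S.x 0)
  | k + 1 => (1 - A.τ k) * averagedF Q t0 A S k + A.τ k * Q.fR (S.xt k)
      + A.τ k / t0 * (Q.fR (S.xt (k + 1)) - Q.fR (S.xt k))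

/-- The parameter sequences of the method for the problem `Q`. -/
abbrev Problem.rule (Q : Problem n m p d) (L σ : Fin n → ℝ) (c t0 ρ0 : ℝ) : Params :=
  paramRule c t0 ρ0 (Q.Lbar σ) (Lh L σ)

/-- The assumptions on the problem and on the parameters used by the convergence analysis. -/
structure Setting (Q : Problem n m p d) (μ L σ : Fin n → ℝ) (Mg t0 c ρ0 : ℝ) : Prop where
  assumptions : Q.Assumptions μ L
  lipschitz : IsLipschitzFun Mg Q.g
  σ_pos : ∀ j, 0 < σ j
  two_lt_c : 2 < c
  two_lt : 2 < c * t0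
  mul_t0_le : n * t0 ≤ 1
  ρ0_pos : 0 < ρ0
  ρ0_le : 8 * Q.Lbar σ * ρ0 ≤ muF μ σ
  L_pos : 0 < Q.Lbar σ + Lh L σ

namespace Setting

variable {Q : Problem n m p d} {μ L σ : Fin n → ℝ} {Mg t0 c ρ0 : ℝ}
  (hs : Setting Q μ L σ Mg t0 c ρ0)
include hs

lemma t0_pos : 0 < t0 := by
  have h1 := hs.two_lt
  have h2 := hs.two_lt_c
  exact pos_of_mul_pos_right (by linarith : 0 < c * t0) (by linarith)

lemma t0_le [NeZero n] : t0 ≤ 1 := by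
  have h1 : (1 : ℝ) ≤ n := by exact_mod_cast NeZero.one_le
  have := hs.t0_pos
  have := hs.mul_t0_le
  nlinarith

omit hs in
lemma Lbar_nonneg : 0 ≤ Q.Lbar σ := by rw [Problem.Lbar]; positivity

lemma Lh_nonneg : 0 ≤ Lh L σ :=
  Real.iSup_nonneg fun j => div_nonneg (hs.assumptions.L_nonneg j) (hs.σ_pos j).le

lemma muF_nonneg : 0 ≤ muF μ σ :=
  Real.iInf_nonneg fun j => div_nonneg (hs.assumptions.μ_pos j).le (hs.σ_pos j).le

lemma curvature_pos {ρ : ℝ} (hρ : 0 < ρ) : 0 < 2 * Q.Lbar σ * ρ + Lh L σ := by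
  have h1 := Lbar_nonneg (Q := Q) (σ := σ)
  have h2 := hs.Lh_nonneg
  rcases h1.eq_or_lt with h | h
  · have := hs.L_pos
    rw [← h] at this ⊢
    linarith
  · positivity

lemma τ_pos {Lb Lσ : ℝ} (k : ℕ) : 0 < (paramRule c t0 ρ0 Lb Lσ).τ k := by
  rw [paramRule_τ hs.two_lt_c]
  exact div_pos hs.t0_pos (scale_pos hs.two_lt_c _)

lemma τ_le [NeZero n] {Lb Lσ : ℝ} (k : ℕ) : (paramRule c t0 ρ0 Lb Lσ).τ k ≤ 1 := by
  rw [paramRule_τ hs.two_lt_c, div_le_one (scale_pos hs.two_lt_c _)]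
  exact hs.t0_le.trans (one_le_scale_succ hs.two_lt_c k)

lemma ρ_pos {Lb Lσ : ℝ} (k : ℕ) : 0 < (paramRule c t0 ρ0 Lb Lσ).ρ k := by
  rw [paramRule_ρ hs.two_lt_c hs.t0_pos]
  have := hs.ρ0_pos
  have := scale_pos hs.two_lt_c (k + 1)
  positivity

lemma step_pos {k : ℕ} (i : Fin n) :
    0 < t0 * (Q.rule L σ c t0 ρ0).β k
      / (σ i * (Q.rule L σ c t0 ρ0).τ k) := by
  rw [paramRule_β]
  have h1 := hs.curvature_pos (hs.ρ_pos (Lb := Q.Lbar σ) (Lσ := Lh L σ) k)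
  have h2 := hs.τ_pos (Lb := Q.Lbar σ) (Lσ := Lh L σ) k
  have h3 := hs.σ_pos i
  have h4 := hs.t0_pos
  positivity

section Run

variable {x0 : BlockSpace p} {yh0 : BlockSpace d} {jk : ℕ → Fin n} {S : Iterates p d}
  (hx0 : x0 ∈ Q.dom)
  (hS : IsRun Q σ t0 (Q.rule L σ c t0 ρ0) x0 yh0 jk S)
include hx0 hS

lemma xt_mem_dom (k : ℕ) : S.xt k ∈ Q.dom := by
  induction k with
  | zero => rw [hS.xt_zero]; exact hx0
  | succ k ih =>
    intro i
    by_cases hi : i = jk k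
    · exact (hS.xt_draw k i hi).mem_effDom (hs.step_pos i) (hs.assumptions.fj_proper i).1 (ih i)
    · rw [hS.xt_keep k i hi]; exact ih i

-- This exhibits `y^{k+1}` as an ordinary augmented Lagrangian multiplier step for the constraint `K
-- x = r`.
omit hx0 hS in
lemma y_succ_eq (k : ℕ) : S.y (k + 1)
    = S.yh k + (Q.rule L σ c t0 ρ0).ρ k • (Q.K (S.xh k) - dualPoint Q (Q.rule L σ c t0 ρ0) S (k + 1)) := by
  rw [dualPoint, smul_sub, smul_inv_smul₀ (hs.ρ_pos k).ne']
  abel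

omit hx0 in
lemma y_succ_subgradient (k : ℕ) (s : BlockSpace d) :
    Q.gR (dualPoint Q (Q.rule L σ c t0 ρ0) S (k + 1)) + inner ℝ (S.y (k + 1)) (s - dualPoint Q (Q.rule L σ c t0 ρ0) S (k + 1))
      ≤ Q.gR s := by
  have h := hS.y_succ k
  rw [Problem.g_eq hs.assumptions hs.lipschitz] at h
  exact h.subgradient_of_conjugate (Problem.convexOn_gR hs.assumptions hs.lipschitz)
    (Problem.continuous_gR hs.assumptions hs.lipschitz) (hs.ρ_pos k) s

-- The long update of `ŷ` collapses to this form once each `y` is expressed through its dual point.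
omit hx0 in
lemma yh_succ_eq (k : ℕ) : S.yh (k + 1) = S.yh k + ((Q.rule L σ c t0 ρ0).ρ k / 2) •
    (residual Q (Q.rule L σ c t0 ρ0) S (k + 1) - (1 - (Q.rule L σ c t0 ρ0).τ k) • residual Q (Q.rule L σ c t0 ρ0) S k) := by
  have hρ := (hs.ρ_pos (Lb := Q.Lbar σ) (Lσ := Lh L σ) k).ne'
  have h := hS.yh_succ k
  rw [paramRule_η, hs.y_succ_eq k] at h
  set ρ := (Q.rule L σ c t0 ρ0).ρ k
  set τ := (Q.rule L σ c t0 ρ0).τ k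
  rcases k with _ | k
  -- At the first iteration the index `k - 1` is truncated to `0`. As `y^0 = ŷ^0` and `x̂^0 = x^0`,
  -- the terms referring to the past cancel, in agreement with the zero initial residual.
  · have hxh : S.xh 0 = S.x 0 := by
      rw [hS.xh_eq, hS.x_zero, hS.xt_zero]; module
    have hres : residual Q (Q.rule L σ c t0 ρ0) S 0 = 0 := sub_self _
    rw [Nat.zero_sub, hxh, hS.yh_zero, hS.y_zero] at h
    rw [hres, h, residual, hS.yh_zero]
    have e1 : ρ / 2 / ρ = 1 / 2 := by field_simp
    simp only [map_sub, sub_self, smul_zero, sub_zero, e1, smul_sub, smul_add, smul_smul]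
    have e2 : 1 / 2 * ρ = ρ / 2 := by ring
    rw [e2]
    module
  · have hρ' := (hs.ρ_pos (Lb := Q.Lbar σ) (Lσ := Lh L σ) k).ne'
    rw [Nat.add_sub_cancel, hs.y_succ_eq k] at h
    set ρ' := (Q.rule L σ c t0 ρ0).ρ k
    rw [h, residual, residual]
    have e1 : ρ / 2 / ρ = 1 / 2 := by field_simp
    have e2 : 1 / 2 * ρ = ρ / 2 := by ring
    have e3 : ρ / 2 * (1 - τ) / ρ' * ρ' = ρ / 2 * (1 - τ) := by field_simp
    simp only [map_sub, map_smul, e1, smul_sub, smul_add, smul_smul, e2, e3]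
    module

/-- In the recursion for `x^{k+1}` the direct coefficient of `x̃^k` is `τ_k - τ_k/τ₀ ≤ 0`, so
convexity cannot be used step by step. The cure is to keep track of the weight `a` that `x^k`
already puts on `x̃^k`; the lower bound `τ_k/τ₀` on it keeps the combined coefficient nonnegative.
The same weights produce `averagedF`. -/
lemma exists_averaging [NeZero n] (k : ℕ) : ∃ a : ℝ, 1 / scale c (k + 1) ≤ a ∧ a ≤ 1 ∧
    ∃ z ∈ Q.dom, ∃ ζ : ℝ, Q.fR z ≤ ζ ∧ S.x k = a • S.xt k + (1 - a) • z ∧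
      averagedF Q t0 (Q.rule L σ c t0 ρ0) S k = a * Q.fR (S.xt k) + (1 - a) * ζ := by
  have hcv := Problem.convexOn_fR hs.assumptions
  induction k with
  | zero =>
    refine ⟨1, ?_, le_rfl, S.xt 0, hs.xt_mem_dom hx0 hS 0, Q.fR (S.xt 0), le_rfl, ?_, ?_⟩
    · rw [div_le_one (scale_pos hs.two_lt_c _)]
      exact one_le_scale_succ hs.two_lt_c 0
    · rw [hS.x_zero, hS.xt_zero]; simp
    · rw [averagedF, hS.x_zero, hS.xt_zero]; ring
  | succ k ih =>
    obtain ⟨a, ha, ha1, z, hz, ζ, hζ, hx, hf⟩ := ih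
    set θ := 1 / scale c (k + 1) with hθ
    have hsc := scale_pos hs.two_lt_c (k + 1)
    have hθ1 : θ ≤ 1 := ha.trans ha1
    have hτ0 := hs.τ_pos (Lb := Q.Lbar σ) (Lσ := Lh L σ) k
    have hτ1 := hs.τ_le (Lb := Q.Lbar σ) (Lσ := Lh L σ) k
    have hτθ : (Q.rule L σ c t0 ρ0).τ k / t0 = θ := by
      rw [paramRule_τ hs.two_lt_c, hθ]
      have := hs.t0_pos
      field_simp
    set τ := (Q.rule L σ c t0 ρ0).τ k with hτ
    have hmono : 1 / scale c (k + 1 + 1) ≤ θ := by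
      refine one_div_le_one_div_of_le hsc ?_
      rw [scale_succ_eq_add (k + 1)]
      have : 0 < 1 / c := one_div_pos.2 (by linarith [hs.two_lt_c])
      linarith
    have hxs : S.x (k + 1) = θ • S.xt (k + 1)
        + (((1 - τ) * a + τ - θ) • S.xt k + ((1 - τ) * (1 - a)) • z) := by
      rw [hS.x_succ, hS.xh_eq, hτθ, ← hτ, hx]; module
    have hfs : averagedF Q t0 (Q.rule L σ c t0 ρ0) S (k + 1) = θ * Q.fR (S.xt (k + 1))
        + (((1 - τ) * a + τ - θ) * Q.fR (S.xt k) + ((1 - τ) * (1 - a)) * ζ) := by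
      rw [averagedF, hτθ, ← hτ, hf]; ring
    -- The coefficient equals `(1 - τ)(a - θ) + τ(1 - θ)`.
    have hc1 : 0 ≤ (1 - τ) * a + τ - θ := by
      nlinarith [mul_nonneg (sub_nonneg.2 hτ1) (sub_nonneg.2 ha), mul_nonneg hτ0.le
        (sub_nonneg.2 hθ1)]
    have hc2 : 0 ≤ (1 - τ) * (1 - a) := mul_nonneg (sub_nonneg.2 hτ1) (sub_nonneg.2 ha1)
    refine ⟨θ, hmono, hθ1, ?_⟩
    -- If `θ = 1`, as at the first step, all the weight sits on `x̃^{k+1}` and the remaining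
    -- coefficients vanish; otherwise they are normalized by `1 - θ`.
    rcases hθ1.eq_or_lt with h1 | h1
    · have h3 : (1 - τ) * a + τ - θ = 0 := by nlinarith
      have h4 : (1 - τ) * (1 - a) = 0 := by nlinarith
      refine ⟨S.xt k, hs.xt_mem_dom hx0 hS k, Q.fR (S.xt k), le_rfl, ?_, ?_⟩
      · rw [hxs, h3, h4, h1]; module
      · rw [hfs, h3, h4, h1]; ring
    · have hpos : 0 < 1 - θ := sub_pos.2 h1
      set u := (1 - θ)⁻¹ * ((1 - τ) * a + τ - θ) with hu
      set v := (1 - θ)⁻¹ * ((1 - τ) * (1 - a)) with hv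
      have hu0 : 0 ≤ u := mul_nonneg (inv_nonneg.2 hpos.le) hc1
      have hv0 : 0 ≤ v := mul_nonneg (inv_nonneg.2 hpos.le) hc2
      have huv : u + v = 1 := by
        rw [hu, hv, ← mul_add]
        rw [inv_mul_eq_one₀ hpos.ne']
        ring
      have hu' : (1 - θ) * u = (1 - τ) * a + τ - θ := by rw [hu, mul_inv_cancel_left₀ hpos.ne']
      have hv' : (1 - θ) * v = (1 - τ) * (1 - a) := by rw [hv, mul_inv_cancel_left₀ hpos.ne']
      refine ⟨u • S.xt k + v • z, hcv.1 (hs.xt_mem_dom hx0 hS k) hz hu0 hv0 huv,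
        u * Q.fR (S.xt k) + v * ζ, ?_, ?_, ?_⟩
      · have h2 := hcv.2 (hs.xt_mem_dom hx0 hS k) hz hu0 hv0 huv
        simp only [smul_eq_mul] at h2
        exact h2.trans (by gcongr)
      · rw [hxs, ← hu', ← hv']; module
      · rw [hfs, ← hu', ← hv']; ring

lemma x_mem_dom_and_fR_le [NeZero n] (k : ℕ) :
    S.x k ∈ Q.dom ∧ Q.fR (S.x k) ≤ averagedF Q t0 (Q.rule L σ c t0 ρ0) S k := by
  have hcv := Problem.convexOn_fR hs.assumptions
  obtain ⟨a, ha, ha1, z, hz, ζ, hζ, hx, hf⟩ := hs.exists_averaging hx0 hS k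
  have ha0 : 0 ≤ a := (one_div_pos.2 (scale_pos hs.two_lt_c _)).le.trans ha
  have hxt := hs.xt_mem_dom hx0 hS k
  rw [hx, hf]
  refine ⟨hcv.1 hxt hz ha0 (sub_nonneg.2 ha1) (by ring), ?_⟩
  have h2 := hcv.2 hxt hz ha0 (sub_nonneg.2 ha1) (by ring)
  simp only [smul_eq_mul] at h2
  have h3 := mul_le_mul_of_nonneg_left hζ (sub_nonneg.2 ha1)
  linarith

lemma gap_nonneg [NeZero n] {xs : BlockSpace p} {ys : BlockSpace d} (hys : Q.IsMultiplier xs ys)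
    (k : ℕ) : 0 ≤ Q.gap xs ys (averagedF Q t0 (Q.rule L σ c t0 ρ0) S k) (S.x k) (dualPoint Q (Q.rule L σ c t0 ρ0) S k) := by
  obtain ⟨h1, h2⟩ := hs.x_mem_dom_and_fR_le hx0 hS k
  have := hys _ h1 (dualPoint Q (Q.rule L σ c t0 ρ0) S k)
  rw [Problem.gap]
  linarith

/-- Replacing `K x` by `r` in `g` costs `M_g` times the residual, and dropping the multiplier term
costs `‖y*‖` times the residual. -/
lemma FR_sub_le [NeZero n] (xs : BlockSpace p) (ys : BlockSpace d) (k : ℕ) :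
    Q.FR (S.x k) - Q.FR xs
      ≤ Q.gap xs ys (averagedF Q t0 (Q.rule L σ c t0 ρ0) S k) (S.x k) (dualPoint Q (Q.rule L σ c t0 ρ0) S k)
        + (Mg + ‖ys‖) * ‖residual Q (Q.rule L σ c t0 ρ0) S k‖ := by
  obtain ⟨h1, h2⟩ := hs.x_mem_dom_and_fR_le hx0 hS k
  have h3 := Problem.gR_le hs.assumptions hs.lipschitz (Q.K (S.x k)) (dualPoint Q (Q.rule L σ c t0 ρ0) S k)
  have h4 := neg_le_of_abs_le (abs_real_inner_le_norm ys (Q.K (S.x k) - dualPoint Q (Q.rule L σ c t0 ρ0) S k))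
  rw [Problem.gap, residual, Problem.FR]
  linarith

end Run

end Setting

/-! ### The Lyapunov function, determinism of runs, and one-step decrease. -/

variable {n m : ℕ} {p : Fin n → ℕ} {d : Fin m → ℕ}

lemma averagedF_congr {Q : Problem n m p d} {t0 : ℝ} {A : Params} {S S' : Iterates p d} {k : ℕ}
    (h : ∀ i ≤ k, S.x i = S'.x i ∧ S.xt i = S'.xt i) :
    averagedF Q t0 A S k = averagedF Q t0 A S' k := by
  induction k with
  | zero => rw [averagedF, averagedF, (h 0 le_rfl).1]
  | succ k ih =>
    rw [averagedF, averagedF, ih fun i hi => h i (hi.trans k.le_succ), (h k k.le_succ).2,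
      (h (k + 1) le_rfl).2]

lemma wnormSq_nonneg {w : Fin n → ℝ} (hw : ∀ j, 0 ≤ w j) (x : BlockSpace p) :
    0 ≤ wnormSq w x :=
  Finset.sum_nonneg fun j _ => mul_nonneg (hw j) (sq_nonneg _)

/-- The Lyapunov function of the method. -/
def lyapunov (Q : Problem n m p d) (μ L σ : Fin n → ℝ) (t0 c ρ0 : ℝ) (xs : BlockSpace p)
    (ys : BlockSpace d) (S : Iterates p d) (k : ℕ) : ℝ :=
  scale c k ^ 2 * Q.gap xs ys (averagedF Q t0 (Q.rule L σ c t0 ρ0) S k) (S.x k)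
      (dualPoint Q (Q.rule L σ c t0 ρ0) S k)
    + ρ0 / 2 * (scale c k ^ 4 * ‖residual Q (Q.rule L σ c t0 ρ0) S k‖ ^ 2)
    + 1 / ρ0 * ‖S.yh k - ys‖ ^ 2
    + t0 * ((2 * Q.Lbar σ * (ρ0 * scale c k ^ 2) + Lh L σ) / 2 + muF μ σ / 2 * scale c k)
      * wnormSq (fun j => n * σ j) (S.xt k - xs)

/-- The scalar comparison behind the decrease of the Lyapunov function. -/
lemma lyapunov_coefficients {s S c t0 ρ0 Lb Lσ μ nn g w e N : ℝ} (hc : 2 < c) (hct : 2 < c * t0)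
    (ht0 : t0 ≤ 1) (hn : 0 < nn) (hnt : nn * t0 ≤ 1) (hρ0 : 0 < ρ0) (hLb : 0 ≤ Lb)
    (hμ : 8 * Lb * ρ0 ≤ μ) (hS : S = s + 1 / c) (hS1 : 1 ≤ S) (hg : 0 ≤ g) (hw : 0 ≤ w)
    (hN : 0 ≤ N) :
    S ^ 2 * ((1 - t0 / S) * g + ρ0 * S ^ 2 / 2 * ((1 - t0 / S) ^ 2 * w)
        + 1 / (ρ0 * S ^ 2) * e
        + t0 / S * (t0 / S / t0 * (2 * Lb * (ρ0 * S ^ 2) + Lσ) / 2 + μ / 2 * (1 - 1 / nn)) * N)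
      ≤ s ^ 2 * g + ρ0 / 2 * (s ^ 4 * w) + 1 / ρ0 * e
        + t0 * ((2 * Lb * (ρ0 * s ^ 2) + Lσ) / 2 + μ / 2 * s) * N
        - (t0 - 2 / c) * (S * (g + ρ0 / 2 * (s ^ 2 * w))) := by
  have hSpos : 0 < S := by linarith
  have hcpos : 0 < c := by linarith
  have ht0pos : 0 < t0 := pos_of_mul_pos_right (by linarith : 0 < c * t0) hcpos.le
  set i := 1 / c with hi
  have hipos : 0 < i := one_div_pos.2 hcpos
  have h2i : 2 / c = 2 * i := by rw [hi]; ring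
  have hit : 2 * i < t0 := by
    rw [← h2i, div_lt_iff₀ hcpos]; linarith
  rw [h2i]
  have hs : s = S - i := by linarith
  -- The left side is `S² - 2 S/c`, which is `(S - 1/c)²` without its last square. The surplus `(t0
  -- - 2/c) S` is positive because `c t0 > 2`.
  have hsq : (S ^ 2 - t0 * S) + (t0 - 2 * i) * S ≤ s ^ 2 := by
    rw [hs]; nlinarith [sq_nonneg i]
  have hq0 : 0 ≤ S ^ 2 - t0 * S := by nlinarith
  have hδ : 0 ≤ (t0 - 2 * i) * S := mul_nonneg (by linarith) hSpos.le
  have hquart : (S ^ 2 - t0 * S) ^ 2 + (t0 - 2 * i) * S * s ^ 2 ≤ s ^ 4 := by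
    have h1 : s ^ 4 = s ^ 2 * s ^ 2 := by ring
    have h2 : S ^ 2 - t0 * S ≤ s ^ 2 := by linarith
    have h3 : (S ^ 2 - t0 * S) * (S ^ 2 - t0 * S) ≤ (S ^ 2 - t0 * S) * s ^ 2 :=
      mul_le_mul_of_nonneg_left h2 hq0
    have h4 := mul_le_mul_of_nonneg_right hsq (sq_nonneg s)
    nlinarith
  -- The growth of the penalty costs at most `(μ/4) S/c`, by `8 Lb ρ0 ≤ μ`. Strong convexity
  -- supplies `(μ/2)(S/nn - 1/c)`, at least `(μ/2) S/c` since `1/nn ≥ t0 > 2/c` and `S ≥ 1`.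
  have hN' : (2 * Lb * (ρ0 * S ^ 2) + Lσ) / 2 + μ / 2 * (S * (1 - 1 / nn))
      ≤ (2 * Lb * (ρ0 * s ^ 2) + Lσ) / 2 + μ / 2 * s := by
    have hn1 : t0 ≤ 1 / nn := by rw [le_div_iff₀ hn]; linarith
    have hμ0 : 0 ≤ μ := le_trans (by positivity) hμ
    have h1 : Lb * ρ0 * (2 * S * i - i ^ 2) ≤ μ / 4 * (S * i) := by
      have hLρ : 0 ≤ Lb * ρ0 := by positivity
      have h2 : Lb * ρ0 * (2 * S * i - i ^ 2) ≤ Lb * ρ0 * (2 * S * i) :=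
        mul_le_mul_of_nonneg_left (by nlinarith [sq_nonneg i]) hLρ
      have h3 := mul_le_mul_of_nonneg_right hμ (by positivity : 0 ≤ S * i)
      nlinarith
    have h4 : S * i ≤ S * (1 / nn) - i := by
      have h5 : S * (2 * i) ≤ S * (1 / nn) :=
        mul_le_mul_of_nonneg_left (by linarith) hSpos.le
      have h6 : 1 * i ≤ S * i := mul_le_mul_of_nonneg_right hS1 hipos.le
      linarith
    have h7 := mul_le_mul_of_nonneg_left h4 (by positivity : 0 ≤ μ / 2)
    have h8 : 0 ≤ μ * (S * i) := by positivity
    rw [hs]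
    nlinarith
  have e1 : S ^ 2 * ((1 - t0 / S) * g + ρ0 * S ^ 2 / 2 * ((1 - t0 / S) ^ 2 * w)
        + 1 / (ρ0 * S ^ 2) * e
        + t0 / S * (t0 / S / t0 * (2 * Lb * (ρ0 * S ^ 2) + Lσ) / 2 + μ / 2 * (1 - 1 / nn)) * N)
      = (S ^ 2 - t0 * S) * g + ρ0 / 2 * ((S ^ 2 - t0 * S) ^ 2 * w) + 1 / ρ0 * e
        + t0 * ((2 * Lb * (ρ0 * S ^ 2) + Lσ) / 2 + μ / 2 * (S * (1 - 1 / nn))) * N := by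
    field_simp
  rw [e1]
  have k1 := mul_le_mul_of_nonneg_right hsq hg
  have k2 := mul_le_mul_of_nonneg_left (mul_le_mul_of_nonneg_right hquart hw)
    (by positivity : 0 ≤ ρ0 / 2)
  have k3 := mul_le_mul_of_nonneg_right (mul_le_mul_of_nonneg_left hN' ht0pos.le) hN
  linarith

namespace Setting

variable {Q : Problem n m p d} {μ L σ : Fin n → ℝ} {Mg t0 c ρ0 : ℝ}
  (hs : Setting Q μ L σ Mg t0 c ρ0)
include hs

lemma y_succ_unique {x0 : BlockSpace p} {yh0 : BlockSpace d} {jk jk' : ℕ → Fin n}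
    {S S' : Iterates p d} (hS : IsRun Q σ t0 (Q.rule L σ c t0 ρ0) x0 yh0 jk S) (hS' : IsRun Q σ t0 (Q.rule L σ c t0 ρ0) x0 yh0 jk' S')
    {k : ℕ} (h1 : S.yh k = S'.yh k) (h2 : S.xh k = S'.xh k) :
    S.y (k + 1) = S'.y (k + 1) := by
  have h := hS.y_succ k
  have h' := hS'.y_succ k
  rw [← h1, ← h2] at h'
  rw [Problem.g_eq hs.assumptions hs.lipschitz] at h h'
  exact h.unique_of_conjugate (Problem.convexOn_gR hs.assumptions hs.lipschitz)
    (Problem.continuous_gR hs.assumptions hs.lipschitz) (hs.ρ_pos k) h'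

section Unique

variable {x0 : BlockSpace p} {yh0 : BlockSpace d} {jk jk' : ℕ → Fin n} {S S' : Iterates p d}
  (hx0 : x0 ∈ Q.dom) (hS : IsRun Q σ t0 (Q.rule L σ c t0 ρ0) x0 yh0 jk S) (hS' : IsRun Q σ t0 (Q.rule L σ c t0 ρ0) x0 yh0 jk' S')
include hx0 hS hS'

/-- A run is determined by the drawn blocks. -/
lemma run_unique (k : ℕ) (h : ∀ i < k, jk i = jk' i) : ∀ i ≤ k, S.x i = S'.x i ∧
    S.xt i = S'.xt i ∧ S.y i = S'.y i ∧ S.yh i = S'.yh i ∧ S.xh i = S'.xh i := by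
  have hxh : ∀ i, S.x i = S'.x i → S.xt i = S'.xt i → S.xh i = S'.xh i := fun i h1 h2 => by
    rw [hS.xh_eq, hS'.xh_eq, h1, h2]
  induction k with
  | zero =>
    intro i hi
    obtain rfl := Nat.le_zero.1 hi
    have h1 : S.x 0 = S'.x 0 := by rw [hS.x_zero, hS'.x_zero]
    have h2 : S.xt 0 = S'.xt 0 := by rw [hS.xt_zero, hS'.xt_zero]
    exact ⟨h1, h2, by rw [hS.y_zero, hS'.y_zero], by rw [hS.yh_zero, hS'.yh_zero], hxh 0 h1 h2⟩
  | succ k ih =>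
    have ih := ih fun i hi => h i (hi.trans k.lt_succ_self)
    intro i hi
    rcases Nat.lt_or_ge i (k + 1) with hlt | hge
    · exact ih i (Nat.lt_succ_iff.1 hlt)
    obtain rfl : i = k + 1 := le_antisymm hi hge
    obtain ⟨k1, k2, k3, k4, k5⟩ := ih k le_rfl
    -- The update of `ŷ` reaches back two indices, so agreement is also needed at `k - 1`, truncated
    -- at zero.
    obtain ⟨-, -, -, l4, l5⟩ := ih (k - 1) (Nat.sub_le k 1)
    have hy := hs.y_succ_unique hS hS' k4 k5
    have hxt : S.xt (k + 1) = S'.xt (k + 1) := by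
      ext b : 1
      by_cases hb : b = jk k
      · have hb' : b = jk' k := hb.trans (h k k.lt_succ_self)
        have h1 := hS.xt_draw k b hb
        have h2 := hS'.xt_draw k b hb'
        rw [← k2, ← k5, ← hy] at h2
        exact h1.unique (hs.step_pos b) (hs.assumptions.μ_pos b).le
          (hs.assumptions.fj_proper b).1 ⟨x0 b, hx0 b⟩ (strongConvexOn_toReal
            (hs.assumptions.fj_proper b).1 (hs.assumptions.fj_strong b)) h2
      · rw [hS.xt_keep k b hb, hS'.xt_keep k b (by rwa [← h k k.lt_succ_self]), k2]
    have hx : S.x (k + 1) = S'.x (k + 1) := by rw [hS.x_succ, hS'.x_succ, k5, hxt, k2]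
    refine ⟨hx, hxt, hy, ?_, hxh _ hx hxt⟩
    rw [hS.yh_succ, hS'.yh_succ, l4, k4, hy, hx, k5, k1, l5, k3]

end Unique

/-- Averaged over the next draw, the Lyapunov function decreases. -/
lemma lyapunov_average_le [NeZero n] {x0 : BlockSpace p} {yh0 : BlockSpace d} (hx0 : x0 ∈ Q.dom)
    {jk : ℕ → Fin n} {S : Iterates p d} (hS : IsRun Q σ t0 (Q.rule L σ c t0 ρ0) x0 yh0 jk S)
    {jk' : Fin n → ℕ → Fin n} {S' : Fin n → Iterates p d}
    (hS' : ∀ i, IsRun Q σ t0 (Q.rule L σ c t0 ρ0) x0 yh0 (jk' i) (S' i)) {k : ℕ}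
    (hpast : ∀ i, ∀ l < k, jk l = jk' i l) (hdraw : ∀ i, jk' i k = i)
    {xs : BlockSpace p} {ys : BlockSpace d} (hxs : xs ∈ Q.dom) (hys : Q.IsMultiplier xs ys) :
    1 / (n : ℝ) * ∑ i, lyapunov Q μ L σ t0 c ρ0 xs ys (S' i) (k + 1)
      ≤ lyapunov Q μ L σ t0 c ρ0 xs ys S k - (t0 - 2 / c) * (scale c (k + 1)
        * (Q.gap xs ys (averagedF Q t0 (Q.rule L σ c t0 ρ0) S k) (S.x k) (dualPoint Q (Q.rule L σ c t0 ρ0) S k)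
          + ρ0 / 2 * (scale c k ^ 2 * ‖residual Q (Q.rule L σ c t0 ρ0) S k‖ ^ 2))) := by
  have hu := fun i => hs.run_unique hx0 hS (hS' i) k (hpast i)
  have hxt : ∀ i, (S' i).xt k = S.xt k := fun i => (hu i k le_rfl).2.1.symm
  have hyh : ∀ i, (S' i).yh k = S.yh k := fun i => (hu i k le_rfl).2.2.2.1.symm
  have hxh : ∀ i, (S' i).xh k = S.xh k := fun i => (hu i k le_rfl).2.2.2.2.symm
  have hy : ∀ i, (S' i).y (k + 1) = S.y (k + 1) := fun i =>
    hs.y_succ_unique (hS' i) hS (hyh i) (hxh i)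
  have hfb : ∀ i, averagedF Q t0 (Q.rule L σ c t0 ρ0) (S' i) k = averagedF Q t0 (Q.rule L σ c t0 ρ0) S k := fun i =>
    (averagedF_congr fun l hl => ⟨(hu i l hl).1, (hu i l hl).2.1⟩).symm
  have hr : ∀ i, dualPoint Q (Q.rule L σ c t0 ρ0) (S' i) (k + 1) = dualPoint Q (Q.rule L σ c t0 ρ0) S (k + 1) := fun i => by
    rw [dualPoint, dualPoint, hyh, hxh, hy]
  have hres : ∀ i, residual Q (Q.rule L σ c t0 ρ0) (S' i) k = residual Q (Q.rule L σ c t0 ρ0) S k := fun i => by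
    have hx : (S' i).x k = S.x k := (hu i k le_rfl).1.symm
    rw [residual, residual, hx]
    rcases k with _ | k
    · rw [dualPoint, dualPoint, hx]
    · obtain ⟨-, -, -, l4, l5⟩ := hu i k k.le_succ
      rw [dualPoint, dualPoint, l4, l5, (hu i (k + 1) le_rfl).2.2.1]
  have hx : ∀ i, (S' i).x (k + 1)
      = S.xh k + ((Q.rule L σ c t0 ρ0).τ k / t0) • ((S' i).xt (k + 1) - S.xt k) := fun i => by
    rw [(hS' i).x_succ, hxh, hxt]
  -- The `n` runs share the past of `S` and differ in draw `k`. By uniqueness of runs their data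
  -- before that draw coincide, which makes them the `n` outcomes of a single iteration.
  have hstep := Problem.average_iteration_le hs.assumptions hs.σ_pos
    (hs.τ_pos (Lb := Q.Lbar σ) (Lσ := Lh L σ) k) (hs.τ_le k) hs.t0_pos hs.mul_t0_le
    (hs.ρ_pos (Lb := Q.Lbar σ) (Lσ := Lh L σ) k) (hs.curvature_pos (hs.ρ_pos k))
    (r := dualPoint Q (Q.rule L σ c t0 ρ0) S k) (ys := ys) (hs.xt_mem_dom hx0 hS k) hxs (hS.xh_eq k)
    (hs.y_succ_eq k) (hs.y_succ_subgradient hS k) (averagedF Q t0 (Q.rule L σ c t0 ρ0) S k)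
    (X := fun i => (S' i).xt (k + 1))
    (fun i l hl => by rw [(hS' i).xt_keep k l (by rwa [hdraw i]), hxt])
    (fun i => by
      have h := (hS' i).xt_draw k i (hdraw i).symm
      rw [hxt, hxh, hy] at h
      exact h)
  have hsc := scale_pos hs.two_lt_c (k + 1)
  have ht0 := hs.t0_pos
  have hρ0 := hs.ρ0_pos
  rw [paramRule_ρ hs.two_lt_c hs.t0_pos, paramRule_τ hs.two_lt_c] at hstep
  have hstep' := mul_le_mul_of_nonneg_left hstep (sq_nonneg (scale c (k + 1)))
  refine le_trans (le_of_eq ?_) (hstep'.trans ((lyapunov_coefficients hs.two_lt_c hs.two_lt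
    hs.t0_le (Nat.cast_pos.2 (NeZero.pos n)) hs.mul_t0_le hs.ρ0_pos Lbar_nonneg hs.ρ0_le
    (scale_succ_eq_add k) (one_le_scale_succ hs.two_lt_c k) (hs.gap_nonneg hx0 hS hys k)
    (sq_nonneg ‖residual Q (Q.rule L σ c t0 ρ0) S k‖) (wnormSq_nonneg (fun j => mul_nonneg n.cast_nonneg
      (hs.σ_pos j).le) _)).trans le_rfl))
  rw [mul_left_comm]
  congr 1
  rw [Finset.mul_sum]
  refine Finset.sum_congr rfl fun i _ => ?_
  rw [lyapunov, hs.yh_succ_eq (hS' i), hres, hyh, residual, averagedF, hfb, hr, hxt, hx,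
    paramRule_τ hs.two_lt_c, paramRule_ρ hs.two_lt_c hs.t0_pos]
  set sc := scale c (k + 1)
  generalize Q.gap _ _ _ _ _ = g
  generalize ‖Q.K _ - _‖ ^ 2 = w2
  have e1 : residual Q (Q.rule L σ c t0 ρ0) S k = Q.K (S.x k) - dualPoint Q (Q.rule L σ c t0 ρ0) S k := rfl
  rw [e1]
  generalize ‖S.yh k + _ - ys‖ ^ 2 = e2
  generalize wnormSq _ _ = N
  field_simp

end Setting

/-! ### Summability and the lower limit with the logarithmic factor. -/

section Sequences

/-- Cauchy condensation reduces this to the harmonic series, using `log 2 ≤ 1`. The summand `1`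
keeps the denominator positive for every `k ≥ 1`. -/
lemma not_summable_one_div_mul_one_add_log :
    ¬ Summable fun k : ℕ => 1 / ((k : ℝ) * (1 + Real.log k)) := by
  have hlog : ∀ k : ℕ, 0 ≤ Real.log k := fun k => Real.log_natCast_nonneg k
  rw [← summable_condensed_iff_of_nonneg]
  · intro h
    have h1 : ∀ k : ℕ, 1 / ((k : ℝ) + 1)
        ≤ (2 : ℝ) ^ k * (1 / (((2 ^ k : ℕ) : ℝ) * (1 + Real.log ((2 ^ k : ℕ) : ℝ)))) := by
      intro k
      have hl : Real.log 2 ≤ 1 := by linarith [Real.log_two_lt_d9]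
      have hl0 : 0 ≤ Real.log 2 := Real.log_nonneg (by norm_num)
      have hk : (0 : ℝ) ≤ k := k.cast_nonneg
      push_cast
      rw [Real.log_pow, mul_one_div, div_mul_cancel_left₀ (by positivity), ← one_div]
      exact one_div_le_one_div_of_le (by positivity) (by nlinarith)
    have h2 : Summable fun k : ℕ => 1 / ((k : ℝ) + 1) :=
      Summable.of_nonneg_of_le (fun k => by positivity) h1 h
    refine Real.not_summable_one_div_natCast ((summable_nat_add_iff 1).1 ?_)
    simpa using h2
  · intro k
    have := hlog k
    positivity
  · intro a b ha hab
    have ha' : (0 : ℝ) < a := Nat.cast_pos.2 ha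
    have hab' : (a : ℝ) ≤ b := Nat.cast_le.2 hab
    have := hlog a
    have := Real.log_le_log ha' hab'
    exact one_div_le_one_div_of_le (by positivity) (by gcongr)

/-- Otherwise `t k` would eventually dominate `ε / (k (1 + log k))`, whose series diverges. -/
lemma frequently_mul_log_mul_lt {t : ℕ → ℝ} (ht : Summable t) {ε : ℝ} (hε : 0 < ε) :
    ∃ᶠ k : ℕ in atTop, k * Real.log k * t k < ε := by
  intro hev
  refine not_summable_one_div_mul_one_add_log ((ht.mul_left ε⁻¹).of_norm_bounded_eventually_nat ?_)
  filter_upwards [hev, eventually_ge_atTop 2] with k hk hk2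
  have hk' : (2 : ℝ) ≤ k := by exact_mod_cast hk2
  have hlog : 0 < Real.log k := Real.log_pos (by linarith)
  rw [Real.norm_of_nonneg (by positivity), ← div_eq_inv_mul, div_le_div_iff₀ (by positivity) hε]
  have h1 : ε ≤ k * Real.log k * t k := not_lt.1 hk
  have h2 : 0 ≤ t k := by
    by_contra h
    have : k * Real.log k * t k ≤ 0 := mul_nonpos_of_nonneg_of_nonpos (by positivity) (by linarith)
    linarith
  nlinarith [mul_nonneg h2 (by linarith : (0 : ℝ) ≤ k)]

/-- Summability of `k a_k` and `k³ b_k` forces `a_k + C √b_k` to be small along a subsequence. -/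
lemma liminf_sq_mul_sqrt_log_eq_zero {a b e : ℕ → ℝ} {C : ℝ} (hC : 0 ≤ C) (ha : ∀ k, 0 ≤ a k)
    (hb : ∀ k, 0 ≤ b k) (he0 : ∀ k, 0 ≤ e k) (he : ∀ k, e k ≤ a k + C * √(b k))
    (hsa : Summable fun k : ℕ => k * a k) (hsb : Summable fun k : ℕ => (k : ℝ) ^ 3 * b k) :
    liminf (fun k : ℕ => (((k : ℝ) ^ 2 * √(Real.log k) * e k : ℝ) : EReal)) atTop = 0 := by
  have hfreq : ∀ ε : ℝ, 0 < ε → ∃ᶠ k : ℕ in atTop, (k : ℝ) ^ 2 * √(Real.log k) * e k ≤ ε := by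
    intro ε hε
    -- On a common subsequence `k² log k · a_k` and `k⁴ log k · b_k` are below `δ²`. Square roots
    -- bound the `√b_k` term by `δ`; for the `a_k` term, `δ ≤ 1` gives `δ² ≤ δ`. The total is at
    -- most `δ (1 + C) ≤ ε`.
    set δ := min 1 (ε / (1 + C)) with hδ
    have hC1 : 0 < 1 + C := by linarith
    have hδ0 : 0 < δ := lt_min one_pos (by positivity)
    have hδ1 : δ ≤ 1 := min_le_left _ _
    have hδε : δ * (1 + C) ≤ ε := (le_div_iff₀ hC1).1 (min_le_right _ _)
    refine ((frequently_mul_log_mul_lt (hsa.add hsb) (by positivity : 0 < δ ^ 2)).and_eventually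
      (eventually_ge_atTop 3)).mono ?_
    rintro k ⟨hk, hk3⟩
    have hk3' : (3 : ℝ) ≤ k := by exact_mod_cast hk3
    have hlog : 1 ≤ Real.log k := by
      rw [Real.le_log_iff_exp_le (by linarith)]
      linarith [Real.exp_one_lt_d9]
    set l := Real.log k
    have hA : 0 ≤ (k : ℝ) ^ 2 * l * a k := by have := ha k; positivity
    have hB : 0 ≤ (k : ℝ) ^ 4 * l * b k := by have := hb k; positivity
    have hsplit : k * l * (k * a k + (k : ℝ) ^ 3 * b k)
        = (k : ℝ) ^ 2 * l * a k + (k : ℝ) ^ 4 * l * b k := by ring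
    rw [hsplit] at hk
    have h1 : (k : ℝ) ^ 2 * √l * a k ≤ δ := by
      have hsl : √l ≤ l := by
        rw [Real.sqrt_le_left (by linarith)]; nlinarith
      have h2 : (k : ℝ) ^ 2 * √l * a k ≤ (k : ℝ) ^ 2 * l * a k := by
        have := ha k
        gcongr
      nlinarith
    have h2 : (k : ℝ) ^ 2 * √l * √(b k) ≤ δ := by
      refine le_of_sq_le_sq ?_ hδ0.le
      rw [mul_pow, mul_pow, Real.sq_sqrt (by linarith), Real.sq_sqrt (hb k)]
      nlinarith
    calc (k : ℝ) ^ 2 * √l * e k ≤ (k : ℝ) ^ 2 * √l * (a k + C * √(b k)) := by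
          have := he k
          gcongr
      _ = (k : ℝ) ^ 2 * √l * a k + C * ((k : ℝ) ^ 2 * √l * √(b k)) := by ring
      _ ≤ δ + C * δ := by gcongr
      _ ≤ ε := by linarith
  refine le_antisymm (le_of_forall_gt fun x hx => ?_) ?_
  · obtain ⟨r, hr0, hrx⟩ := EReal.lt_iff_exists_real_btwn.1 hx
    refine lt_of_le_of_lt (liminf_le_of_frequently_le' ((hfreq r (by exact_mod_cast hr0)).mono ?_))
      hrx
    intro k hk
    exact_mod_cast hk
  · refine le_liminf_of_le (by isBoundedDefault) (Eventually.of_forall fun k => ?_)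
    have := he0 k
    have h : (0 : ℝ) ≤ (k : ℝ) ^ 2 * √(Real.log k) * e k := by positivity
    exact_mod_cast h

end Sequences

/-! ### Expected decrease, summation and expected bounds. -/

variable {n m : ℕ} {p : Fin n → ℕ} {d : Fin m → ℕ}

/-- The variance is nonnegative. -/
lemma integral_le_sqrt_integral_sq {Ω : Type*} [MeasurableSpace Ω] {P : Measure Ω}
    [IsProbabilityMeasure P] {X : Ω → ℝ} (hX : Integrable X P)
    (hX2 : Integrable (fun ω => X ω ^ 2) P) : ∫ ω, X ω ∂P ≤ √(∫ ω, X ω ^ 2 ∂P) := by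
  refine Real.le_sqrt_of_sq_le ?_
  set M := ∫ ω, X ω ∂P with hM
  have h : 0 ≤ ∫ ω, (X ω - M) ^ 2 ∂P := integral_nonneg fun ω => sq_nonneg _
  have e : ∀ ω, (X ω - M) ^ 2 = X ω ^ 2 - 2 * M * X ω + M ^ 2 := fun ω => by ring
  simp only [e] at h
  have hi : Integrable (fun ω => X ω ^ 2 - 2 * M * X ω) P := hX2.sub (hX.const_mul _)
  rw [integral_add hi (integrable_const _), integral_sub hX2 (hX.const_mul _), integral_const_mul, ← hM, integral_const] at h
  simp only [probReal_univ, one_smul] at h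
  linarith

lemma integral_sub_const_mul {Ω : Type*} [MeasurableSpace Ω] {P : Measure Ω} {X Y Z : Ω → ℝ}
    (hX : Integrable X P) (hY : Integrable Y P) (hZ : Integrable Z P) (a b c d : ℝ) :
    ∫ ω, X ω ∂P - a * (b * (∫ ω, Y ω ∂P + c * (d * ∫ ω, Z ω ∂P)))
      = ∫ ω, (X ω - a * (b * (Y ω + c * (d * Z ω)))) ∂P := by
  have h1 : Integrable (fun ω => c * (d * Z ω)) P := (hZ.const_mul d).const_mul c
  have h2 : Integrable (fun ω => a * (b * (Y ω + c * (d * Z ω)))) P :=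
    ((hY.add h1).const_mul b).const_mul a
  rw [integral_sub hX h2, integral_const_mul, integral_const_mul, integral_add hY h1,
    integral_const_mul, integral_const_mul]

namespace Setting

variable {Q : Problem n m p d} {μ L σ : Fin n → ℝ} {Mg t0 c ρ0 : ℝ}
  (hs : Setting Q μ L σ Mg t0 c ρ0)
include hs

lemma gap_add_residual_le_lyapunov (S : Iterates p d) (xs : BlockSpace p) (ys : BlockSpace d)
    (k : ℕ) :
    scale c k ^ 2 * Q.gap xs ys
        (averagedF Q t0 (Q.rule L σ c t0 ρ0) S k) (S.x k)
        (dualPoint Q (Q.rule L σ c t0 ρ0) S k)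
      + ρ0 / 2 * (scale c k ^ 4
        * ‖residual Q (Q.rule L σ c t0 ρ0) S k‖ ^ 2)
      ≤ lyapunov Q μ L σ t0 c ρ0 xs ys S k := by
  have h1 := hs.ρ0_pos
  have h2 := scale_pos hs.two_lt_c k
  have h3 := hs.t0_pos
  have h4 := Lbar_nonneg (Q := Q) (σ := σ)
  have h5 := hs.Lh_nonneg
  have h6 := hs.muF_nonneg
  have h7 := wnormSq_nonneg (fun j => mul_nonneg n.cast_nonneg (hs.σ_pos j).le) (S.xt k - xs)
  have h8 : 0 ≤ 1 / ρ0 * ‖S.yh k - ys‖ ^ 2 := by positivity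
  have h9 : 0 ≤ t0 * ((2 * Q.Lbar σ * (ρ0 * scale c k ^ 2) + Lh L σ) / 2
      + muF μ σ / 2 * scale c k) * wnormSq (fun j => n * σ j) (S.xt k - xs) :=
    mul_nonneg (by positivity) h7
  rw [lyapunov]
  linarith

lemma lyapunov_zero_le {x0 : BlockSpace p} {yh0 : BlockSpace d}
    {jk : ℕ → Fin n} {S : Iterates p d}
    (hS : IsRun Q σ t0 (Q.rule L σ c t0 ρ0) x0 yh0 jk S) {xs : BlockSpace p}
    (ys : BlockSpace d) (hle : Q.FR xs ≤ Q.FR x0) :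
    lyapunov Q μ L σ t0 c ρ0 xs ys S 0 ≤ Q.FR x0 - Q.FR xs
      + t0 * (Lh L σ + 2 * Q.Lbar σ * ρ0 + muF μ σ) / 2 * wnormSq (fun j => n * σ j) (x0 - xs)
      + 1 / ρ0 * ‖yh0 - ys‖ ^ 2 := by
  have h0 := scale_pos hs.two_lt_c 0
  -- The initial scale is `(c - 1)/c < 1`, so each weight of the Lyapunov function at zero is at
  -- most the matching weight in the stated constant.
  have h1 : scale c 0 ≤ 1 := by
    have := hs.two_lt_c
    rw [scale, div_le_one (by linarith)]; push_cast; linarith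
  have hsq : scale c 0 ^ 2 ≤ 1 := pow_le_one₀ h0.le h1
  have h3 := hs.t0_pos
  have h4 := Lbar_nonneg (Q := Q) (σ := σ)
  have h6 := hs.muF_nonneg
  have hρ := hs.ρ0_pos
  have h7 := wnormSq_nonneg (fun j => mul_nonneg n.cast_nonneg (hs.σ_pos j).le) (x0 - xs)
  rw [lyapunov, residual, dualPoint, averagedF, Problem.gap, hS.x_zero, hS.xt_zero, hS.yh_zero,
    sub_self, inner_zero_right, norm_zero]
  have e1 : Q.fR x0 + Q.h x0 + Q.gR (Q.K x0) + 0 - Q.FR xs = Q.FR x0 - Q.FR xs := by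
    rw [add_zero]; rfl
  rw [e1]
  have h8 : scale c 0 ^ 2 * (Q.FR x0 - Q.FR xs) ≤ Q.FR x0 - Q.FR xs :=
    mul_le_of_le_one_left (sub_nonneg.2 hle) hsq
  have h9 : t0 * ((2 * Q.Lbar σ * (ρ0 * scale c 0 ^ 2) + Lh L σ) / 2 + muF μ σ / 2 * scale c 0)
      ≤ t0 * (Lh L σ + 2 * Q.Lbar σ * ρ0 + muF μ σ) / 2 := by
    have k1 : Q.Lbar σ * ρ0 * scale c 0 ^ 2 ≤ Q.Lbar σ * ρ0 * 1 := by gcongr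
    have k2 : muF μ σ * scale c 0 ≤ muF μ σ * 1 := by gcongr
    have k3 : (2 * Q.Lbar σ * (ρ0 * scale c 0 ^ 2) + Lh L σ) / 2 + muF μ σ / 2 * scale c 0
      ≤ (Lh L σ + 2 * Q.Lbar σ * ρ0 + muF μ σ) / 2 := by linarith
    have k4 := mul_le_mul_of_nonneg_left k3 h3.le
    linarith
  have h10 := mul_le_mul_of_nonneg_right h9 h7
  linarith

section Expectation

variable [NeZero n] {Ω : Type*} [MeasurableSpace Ω] {P : Measure Ω} [IsProbabilityMeasure P]
  {j : ℕ → Ω → Fin n} (hjm : ∀ k, Measurable (j k)) (hji : iIndepFun j P)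
  (hjq : ∀ k i, P {ω | j k ω = i} = ENNReal.ofReal (1 / (n : ℝ)))
  {x0 : BlockSpace p} {yh0 : BlockSpace d} (hx0 : x0 ∈ Q.dom) {S : Ω → Iterates p d}
  (hS : ∀ ω, IsRun Q σ t0 (Q.rule L σ c t0 ρ0) x0 yh0 (fun k => j k ω) (S ω))
include hx0 hS

-- All ingredients of the Lyapunov function at time `k` are gathered in one tuple, so the dependence
-- on the past of each derived quantity follows from it.
omit [NeZero n] [MeasurableSpace Ω] in
lemma dependsOnPast_terms (k : ℕ) : DependsOnPast j k fun ω =>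
    ((S ω).x k, averagedF Q t0 (Q.rule L σ c t0 ρ0) (S ω) k,
      dualPoint Q (Q.rule L σ c t0 ρ0) (S ω) k, (S ω).xt k, (S ω).yh k) := by
  intro ω ω' h
  have hu := hs.run_unique hx0 (hS ω) (hS ω') k h
  obtain ⟨h1, h2, h3, h4, h5⟩ := hu k le_rfl
  have h6 := averagedF_congr (Q := Q) (t0 := t0)
    (A := Q.rule L σ c t0 ρ0) fun l hl => ⟨(hu l hl).1, (hu l hl).2.1⟩
  have h7 : dualPoint Q (Q.rule L σ c t0 ρ0) (S ω) k
      = dualPoint Q (Q.rule L σ c t0 ρ0) (S ω') k := by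
    rcases k with _ | k
    · rw [dualPoint, dualPoint, h1]
    · obtain ⟨-, -, -, l4, l5⟩ := hu k k.le_succ
      rw [dualPoint, dualPoint, l4, l5, h3]
  simp only [h1, h2, h4, h6, h7]

omit [NeZero n] [MeasurableSpace Ω] in
lemma dependsOnPast_gap (xs : BlockSpace p) (ys : BlockSpace d) (k : ℕ) :
    DependsOnPast j k fun ω => Q.gap xs ys
      (averagedF Q t0 (Q.rule L σ c t0 ρ0) (S ω) k) ((S ω).x k)
      (dualPoint Q (Q.rule L σ c t0 ρ0) (S ω) k) := fun ω ω' h => by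
  have := hs.dependsOnPast_terms hx0 hS k ω ω' h
  simp only [Prod.mk.injEq] at this
  obtain ⟨h1, h2, h3, -, -⟩ := this
  simp only [h1, h2, h3]

omit [NeZero n] [MeasurableSpace Ω] in
lemma dependsOnPast_residual (k : ℕ) : DependsOnPast j k fun ω =>
    ‖residual Q (Q.rule L σ c t0 ρ0) (S ω) k‖ := fun ω ω' h => by
  have := hs.dependsOnPast_terms hx0 hS k ω ω' h
  simp only [Prod.mk.injEq] at this
  obtain ⟨h1, -, h3, -, -⟩ := this
  simp only [residual, h1, h3]

omit [NeZero n] [MeasurableSpace Ω] in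
lemma dependsOnPast_lyapunov (xs : BlockSpace p) (ys : BlockSpace d) (k : ℕ) :
    DependsOnPast j k fun ω => lyapunov Q μ L σ t0 c ρ0 xs ys (S ω) k := fun ω ω' h => by
  have := hs.dependsOnPast_terms hx0 hS k ω ω' h
  simp only [Prod.mk.injEq] at this
  obtain ⟨h1, h2, h3, h4, h5⟩ := this
  simp only [lyapunov, residual, h1, h2, h3, h4, h5]

omit [NeZero n] [MeasurableSpace Ω] in
lemma dependsOnPast_FR (k : ℕ) : DependsOnPast j k fun ω => Q.FR ((S ω).x k) :=
  fun ω ω' h => by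
  have := hs.dependsOnPast_terms hx0 hS k ω ω' h
  simp only [Prod.mk.injEq] at this
  simp only [this.1]

include hjm hji hjq

lemma integrable_FR (k : ℕ) : Integrable (fun ω => Q.FR ((S ω).x k)) P :=
  (hs.dependsOnPast_FR hx0 hS k).integrable hjm hji hjq

lemma integrable_gap (xs : BlockSpace p) (ys : BlockSpace d) (k : ℕ) :
    Integrable (fun ω => Q.gap xs ys
      (averagedF Q t0 (Q.rule L σ c t0 ρ0) (S ω) k) ((S ω).x k)
      (dualPoint Q (Q.rule L σ c t0 ρ0) (S ω) k)) P :=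
  (hs.dependsOnPast_gap hx0 hS xs ys k).integrable hjm hji hjq

lemma integrable_residual (k : ℕ) : Integrable (fun ω =>
    ‖residual Q (Q.rule L σ c t0 ρ0) (S ω) k‖) P :=
  (hs.dependsOnPast_residual hx0 hS k).integrable hjm hji hjq

lemma integrable_residual_sq (k : ℕ) : Integrable (fun ω =>
    ‖residual Q (Q.rule L σ c t0 ρ0) (S ω) k‖ ^ 2) P :=
  DependsOnPast.integrable hjm hji hjq (k := k) fun ω ω' h => by
    have := hs.dependsOnPast_residual hx0 hS k ω ω' h
    simp only at this
    simp only [this]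

lemma integrable_lyapunov (xs : BlockSpace p) (ys : BlockSpace d) (k : ℕ) :
    Integrable (fun ω => lyapunov Q μ L σ t0 c ρ0 xs ys (S ω) k) P :=
  (hs.dependsOnPast_lyapunov hx0 hS xs ys k).integrable hjm hji hjq

variable {xs : BlockSpace p} {ys : BlockSpace d} (hxs : xs ∈ Q.dom) (hys : Q.IsMultiplier xs ys)
include hxs hys

lemma expected_lyapunov_succ_le (k : ℕ) :
    ∫ ω, lyapunov Q μ L σ t0 c ρ0 xs ys (S ω) (k + 1) ∂P
      ≤ ∫ ω, lyapunov Q μ L σ t0 c ρ0 xs ys (S ω) k ∂P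
        - (t0 - 2 / c) * (scale c (k + 1) * (∫ ω, Q.gap xs ys
          (averagedF Q t0 (Q.rule L σ c t0 ρ0) (S ω) k) ((S ω).x k)
          (dualPoint Q (Q.rule L σ c t0 ρ0) (S ω) k) ∂P
        + ρ0 / 2 * (scale c k ^ 2 * ∫ ω,
          ‖residual Q (Q.rule L σ c t0 ρ0) (S ω) k‖ ^ 2 ∂P))) := by
  have hg := hs.integrable_gap hjm hji hjq hx0 hS xs ys k
  have hr := hs.integrable_residual_sq hjm hji hjq hx0 hS k
  have hl := hs.integrable_lyapunov hjm hji hjq hx0 hS xs ys k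
  rw [integral_sub_const_mul hl hg hr]
  refine DependsOnPast.integral_le hjm hji hjq
    (hs.dependsOnPast_lyapunov hx0 hS xs ys (k + 1)) (k := k) ?_ ?_
  · intro ω ω' h
    have h1 := hs.dependsOnPast_lyapunov hx0 hS xs ys k ω ω' h
    have h2 := hs.dependsOnPast_gap hx0 hS xs ys k ω ω' h
    have h3 := hs.dependsOnPast_residual hx0 hS k ω ω' h
    simp only at h1 h2 h3
    simp only [h1, h2, h3]
  · intro ω ω' hpast hdraw
    exact hs.lyapunov_average_le hx0 (hS ω) (fun i => hS (ω' i)) hpast hdraw hxs hys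

/-- The expected Lyapunov function plus the accumulated decrease stays below the initial value. -/
lemma expected_lyapunov_add_sum_le {E0 : ℝ}
    (hE0 : ∀ ω, lyapunov Q μ L σ t0 c ρ0 xs ys (S ω) 0 ≤ E0) (k : ℕ) :
    ∫ ω, lyapunov Q μ L σ t0 c ρ0 xs ys (S ω) k ∂P
      + (t0 - 2 / c) * ∑ l ∈ Finset.range k, scale c (l + 1) * (∫ ω, Q.gap xs ys
          (averagedF Q t0 (Q.rule L σ c t0 ρ0) (S ω) l) ((S ω).x l)
          (dualPoint Q (Q.rule L σ c t0 ρ0) (S ω) l) ∂P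
        + ρ0 / 2 * (scale c l ^ 2 * ∫ ω,
          ‖residual Q (Q.rule L σ c t0 ρ0) (S ω) l‖ ^ 2 ∂P)) ≤ E0 := by
  induction k with
  | zero =>
    rw [Finset.range_zero, Finset.sum_empty, mul_zero, add_zero]
    refine (integral_mono (hs.integrable_lyapunov hjm hji hjq hx0 hS xs ys 0)
      (integrable_const E0) hE0).trans_eq ?_
    rw [integral_const, probReal_univ, one_smul]
  | succ k ih =>
    rw [Finset.sum_range_succ, mul_add]
    have := hs.expected_lyapunov_succ_le hjm hji hjq hx0 hS hxs hys k
    linarith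

/-- Expected Lagrangian gap and squared residual: rate and summability. -/
lemma exists_expected_bounds {E0 : ℝ}
    (hE0 : ∀ ω, lyapunov Q μ L σ t0 c ρ0 xs ys (S ω) 0 ≤ E0) :
    ∃ a b : ℕ → ℝ, (∀ k, 0 ≤ a k) ∧ (∀ k, 0 ≤ b k) ∧
      (∀ k, ∫ ω, (Q.FR ((S ω).x k) - Q.FR xs) ∂P ≤ a k + (Mg + ‖ys‖) * √(b k)) ∧
      (∀ k, scale c k ^ 2 * a k ≤ E0) ∧ (∀ k, ρ0 / 2 * (scale c k ^ 4 * b k) ≤ E0) ∧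
      (Summable fun k : ℕ => k * a k) ∧ Summable fun k : ℕ => (k : ℝ) ^ 3 * b k := by
  set a : ℕ → ℝ := fun k => ∫ ω, Q.gap xs ys
    (averagedF Q t0 (Q.rule L σ c t0 ρ0) (S ω) k) ((S ω).x k)
    (dualPoint Q (Q.rule L σ c t0 ρ0) (S ω) k) ∂P with ha_def
  set b : ℕ → ℝ := fun k => ∫ ω,
    ‖residual Q (Q.rule L σ c t0 ρ0) (S ω) k‖ ^ 2 ∂P with hb_def
  have hρ0 := hs.ρ0_pos
  have hc := hs.two_lt_c
  have hcpos : 0 < c := by linarith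
  have ha : ∀ k, 0 ≤ a k := fun k => integral_nonneg fun ω => hs.gap_nonneg hx0 (hS ω) hys k
  have hb : ∀ k, 0 ≤ b k := fun k => integral_nonneg fun ω => sq_nonneg _
  have hδ : 0 < t0 - 2 / c := by
    have := hs.two_lt
    rw [sub_pos, div_lt_iff₀ hcpos]; linarith
  have hterm : ∀ k, 0 ≤ scale c (k + 1) * (a k + ρ0 / 2 * (scale c k ^ 2 * b k)) := fun k => by
    have := scale_pos hc (k + 1)
    have := ha k
    have := hb k
    positivity
  have hmain := hs.expected_lyapunov_add_sum_le hjm hji hjq hx0 hS hxs hys hE0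
  have hlow : ∀ k, scale c k ^ 2 * a k + ρ0 / 2 * (scale c k ^ 4 * b k)
      ≤ ∫ ω, lyapunov Q μ L σ t0 c ρ0 xs ys (S ω) k ∂P := fun k => by
    have hg := hs.integrable_gap hjm hji hjq hx0 hS xs ys k
    have hr := hs.integrable_residual_sq hjm hji hjq hx0 hS k
    rw [ha_def, hb_def]
    simp only
    rw [← integral_const_mul, ← integral_const_mul, ← integral_const_mul,
      ← integral_add (hg.const_mul _) ((hr.const_mul _).const_mul _)]
    exact integral_mono ((hg.const_mul _).add ((hr.const_mul _).const_mul _))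
      (hs.integrable_lyapunov hjm hji hjq hx0 hS xs ys k)
      fun ω => hs.gap_add_residual_le_lyapunov (S ω) xs ys k
  have hlow0 : ∀ k, 0 ≤ scale c k ^ 2 * a k ∧ 0 ≤ ρ0 / 2 * (scale c k ^ 4 * b k) := fun k => by
    have := ha k
    have := hb k
    constructor <;> positivity
  have hbound : ∀ k, scale c k ^ 2 * a k + ρ0 / 2 * (scale c k ^ 4 * b k) ≤ E0 := fun k => by
    have h1 : 0 ≤ (t0 - 2 / c) * ∑ l ∈ Finset.range k,
        scale c (l + 1) * (a l + ρ0 / 2 * (scale c l ^ 2 * b l)) :=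
      mul_nonneg hδ.le (Finset.sum_nonneg fun l _ => hterm l)
    have h2 := hmain k
    have h3 := hlow k
    linarith
  -- The Lyapunov term is nonnegative, so the accumulated surplus never exceeds `E0`.
  have hsum : Summable fun k => scale c (k + 1) * (a k + ρ0 / 2 * (scale c k ^ 2 * b k)) := by
    refine summable_of_sum_range_le (c := E0 / (t0 - 2 / c)) hterm fun k => ?_
    rw [le_div_iff₀ hδ, mul_comm]
    have h2 := hmain k
    have h3 := hlow k
    have h4 := hlow0 k
    linarith
  have hscale : ∀ k : ℕ, (k : ℝ) / c ≤ scale c k := fun k => by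
    rw [scale]; gcongr; linarith
  have hscale' : ∀ k : ℕ, (k : ℝ) / c ≤ scale c (k + 1) := fun k => by
    rw [scale_succ]; gcongr; linarith
  refine ⟨a, b, ha, hb, fun k => ?_, fun k => ?_, fun k => ?_, ?_, ?_⟩
  · have hg := hs.integrable_gap hjm hji hjq hx0 hS xs ys k
    have hr := hs.integrable_residual hjm hji hjq hx0 hS k
    have hr2 := hs.integrable_residual_sq hjm hji hjq hx0 hS k
    have hM : 0 ≤ Mg + ‖ys‖ := add_nonneg hs.lipschitz.1 (norm_nonneg _)
    calc ∫ ω, (Q.FR ((S ω).x k) - Q.FR xs) ∂P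
        ≤ ∫ ω, (Q.gap xs ys
            (averagedF Q t0 (Q.rule L σ c t0 ρ0) (S ω) k) ((S ω).x k)
            (dualPoint Q (Q.rule L σ c t0 ρ0) (S ω) k) + (Mg + ‖ys‖)
          * ‖residual Q (Q.rule L σ c t0 ρ0) (S ω) k‖) ∂P :=
          integral_mono ((hs.integrable_FR hjm hji hjq hx0 hS k).sub (integrable_const _))
            (hg.add (hr.const_mul _)) fun ω => hs.FR_sub_le hx0 (hS ω) xs ys k
      _ = a k + (Mg + ‖ys‖) * ∫ ω,
          ‖residual Q (Q.rule L σ c t0 ρ0) (S ω) k‖ ∂P := by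
          rw [integral_add hg (hr.const_mul _), integral_const_mul]
      _ ≤ a k + (Mg + ‖ys‖) * √(b k) := by
          gcongr
          exact integral_le_sqrt_integral_sq hr hr2
  · have := hbound k
    have := hlow0 k
    linarith
  · have := hbound k
    have := hlow0 k
    linarith
  · refine Summable.of_nonneg_of_le (fun k => mul_nonneg k.cast_nonneg (ha k)) (fun k => ?_)
      (hsum.mul_left c)
    have h1 := (div_le_iff₀' hcpos).1 (hscale' k)
    have h2 := ha k
    have h3 := hb k
    have h4 := scale_pos hc (k + 1)
    calc (k : ℝ) * a k ≤ c * scale c (k + 1) * a k := by gcongr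
      _ ≤ c * scale c (k + 1) * (a k + ρ0 / 2 * (scale c k ^ 2 * b k)) := by
          gcongr
          have : 0 ≤ ρ0 / 2 * (scale c k ^ 2 * b k) := by positivity
          linarith
      _ = _ := by ring
  -- From `k ≤ c s_{k+1}` and `k ≤ c s_k` one gets `k³ ≤ c³ s_{k+1} s_k²`; the factor `2/ρ0` undoes
  -- the weight `ρ0/2`.
  · refine Summable.of_nonneg_of_le (fun k => mul_nonneg (by positivity) (hb k)) (fun k => ?_)
      (hsum.mul_left (c ^ 3 * (2 / ρ0)))
    have h1 := (div_le_iff₀' hcpos).1 (hscale' k)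
    have h1' := (div_le_iff₀' hcpos).1 (hscale k)
    have h2 := ha k
    have h3 := hb k
    have h4 := scale_pos hc (k + 1)
    have h5 := scale_pos hc k
    calc (k : ℝ) ^ 3 * b k = k * (k : ℝ) ^ 2 * b k := by ring
      _ ≤ (c * scale c (k + 1)) * (c * scale c k) ^ 2 * b k := by gcongr
      _ = c ^ 3 * (2 / ρ0) * (scale c (k + 1) * (ρ0 / 2 * (scale c k ^ 2 * b k))) := by
          field_simp
      _ ≤ c ^ 3 * (2 / ρ0) * (scale c (k + 1) * (a k + ρ0 / 2 * (scale c k ^ 2 * b k))) := by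
          gcongr
          linarith

end Expectation

end Setting

end SemiRandPD

end

/-! ### Assembly of the convergence theorem. -/

theorem theorem4p3
    {n m : ℕ} [NeZero n] [NeZero m] {p : Fin n → ℕ} {d : Fin m → ℕ}
    (Q : SemiRandPD.Problem n m p d)
    -- convexity and smoothness moduli, weights, probability vectors
    (μ L σ : Fin n → ℝ) (hQ : Q.Assumptions μ L)
    (hσ : ∀ j, 0 < σ j)
    (qhat : Fin m → ℝ) (hqhat : SemiRandPD.IsPosProb qhat)
    (q : Fin n → ℝ) (hq : ∀ j, q j = 1 / (n : ℝ))
    (Mg : ℝ) (hg : SemiRandPD.IsLipschitzFun Mg Q.g)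
    (hne : ∃ x, Q.IsPrimalSolution x)
    -- algorithmic parameters
    (τ₀ : ℝ) (hτ₀ : τ₀ = SemiRandPD.tau0 qhat q)
    (c : ℝ) (hc : 2 < c) (hcτ : 2 < c * τ₀)
    (ρ₀ : ℝ) (hρ₀ : 0 < ρ₀) (hρ₀' : 8 * Q.Lbar σ * ρ₀ ≤ SemiRandPD.muF μ σ)
    -- the step size `β_k` is well defined
    (hLpos : 0 < Q.Lbar σ + SemiRandPD.Lh L σ)
    -- initial point
    (x₀ : SemiRandPD.BlockSpace p) (hx₀ : Q.F x₀ ≠ ⊤) (yh₀ : SemiRandPD.BlockSpace d)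
    -- independent random indices, each distributed according to `q`
    {Ω : Type*} [MeasurableSpace Ω] (P : Measure Ω) [IsProbabilityMeasure P]
    (j : ℕ → Ω → Fin n) (hjm : ∀ k, Measurable (j k)) (hji : iIndepFun j P)
    (hjq : ∀ k i, P {ω | j k ω = i} = ENNReal.ofReal (q i))
    -- the iterates
    (S : Ω → SemiRandPD.Iterates p d)
    (hS : ∀ ω, SemiRandPD.IsRun Q σ τ₀
      (SemiRandPD.paramRule c τ₀ ρ₀ (Q.Lbar σ) (SemiRandPD.Lh L σ)) x₀ yh₀
      (fun k => j k ω) (S ω)) :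
    -- the expectations are expectations of finite integrable quantities
    (∀ k, (∀ᵐ ω ∂P, Q.F ((S ω).x k) ≠ ⊤) ∧
      Integrable (fun ω => (Q.F ((S ω).x k)).toReal) P) ∧
    -- the bound, for every primal solution `xs` and every dual solution `ys`
    (∀ xs ys, Q.IsPrimalSolution xs → Q.IsDualSolution ys → ∀ k : ℕ,
      ∫ ω, ((Q.F ((S ω).x k)).toReal - Q.Fstar.toReal) ∂P ≤
        (c ^ 2 * SemiRandPD.E0sq Q μ L σ q τ₀ ρ₀ x₀ xs yh₀ ys
          + c ^ 2 * (Mg + ‖ys‖) * √(SemiRandPD.E0sq Q μ L σ q τ₀ ρ₀ x₀ xs yh₀ ys) * √(2 / ρ₀))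
          / ((k : ℝ) + c - 1) ^ 2) ∧
    -- the lower limit
    liminf (fun k : ℕ => (((k : ℝ) ^ 2 * √(Real.log k) *
      ∫ ω, ((Q.F ((S ω).x k)).toReal - Q.Fstar.toReal) ∂P : ℝ) : EReal)) atTop = 0 ∧
    -- the rate
    SemiRandPD.IsLiminfLittleO
      (fun k => (∫ ω, (Q.F ((S ω).x k)).toReal ∂P) - Q.Fstar.toReal)
      (fun k => 1 / ((k : ℝ) ^ 2 * √(Real.log k))) := by
  have hn0 : (0 : ℝ) < n := Nat.cast_pos.2 (NeZero.pos n)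
  have hqn : (⨅ j, q j) = 1 / (n : ℝ) := by simp only [hq, ciInf_const]
  have hτn : τ₀ ≤ 1 / (n : ℝ) := by
    rw [hτ₀, ← hqn]; exact min_le_right _ _
  have hs : SemiRandPD.Setting Q μ L σ Mg τ₀ c ρ₀ :=
    ⟨hQ, hg, hσ, hc, hcτ, by rw [← le_div_iff₀' hn0]; exact hτn, hρ₀, hρ₀', hLpos⟩
  have hx₀' : x₀ ∈ Q.dom := (SemiRandPD.Problem.F_ne_top_iff hQ hg).1 hx₀
  have hjq' : ∀ k i, P {ω | j k ω = i} = ENNReal.ofReal (1 / (n : ℝ)) := fun k i => by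
    rw [hjq, hq]
  have hdom : ∀ ω k, (S ω).x k ∈ Q.dom := fun ω k =>
    (hs.x_mem_dom_and_fR_le hx₀' (hS ω) k).1
  have hF : ∀ ω k, (Q.F ((S ω).x k)).toReal = Q.FR ((S ω).x k) := fun ω k => by
    rw [SemiRandPD.Problem.F_eq_coe hQ hg (hdom ω k), EReal.toReal_coe]
  have hint := hs.integrable_FR hjm hji hjq' hx₀' hS
  have hE0 : ∀ xs ys, Q.IsPrimalSolution xs → ∀ ω,
      SemiRandPD.lyapunov Q μ L σ τ₀ c ρ₀ xs ys (S ω) 0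
        ≤ SemiRandPD.E0sq Q μ L σ q τ₀ ρ₀ x₀ xs yh₀ ys := by
    intro xs ys hxs ω
    have hw : (fun j => σ j / q j) = fun j => n * σ j := by
      funext i
      rw [hq, div_div_eq_mul_div, div_one, mul_comm]
    rw [SemiRandPD.E0sq, hw, hxs.Fstar_eq hQ hg hx₀', SemiRandPD.Problem.F_eq_coe hQ hg hx₀',
      EReal.toReal_coe]
    exact hs.lyapunov_zero_le (hS ω) ys (hxs.FR_le hQ hg hx₀')
  obtain ⟨xs₀, hxs₀⟩ := hne
  have hFs := hxs₀.Fstar_eq hQ hg hx₀'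
  have hlim : liminf (fun k : ℕ => (((k : ℝ) ^ 2 * √(Real.log k) *
      ∫ ω, ((Q.F ((S ω).x k)).toReal - Q.Fstar.toReal) ∂P : ℝ) : EReal)) atTop = 0 := by
    -- The lower limit does not mention a dual solution; any multiplier, supplied by separation,
    -- suffices.
    obtain ⟨ys, hys⟩ := SemiRandPD.Problem.exists_isMultiplier hQ hg hxs₀ hx₀'
    obtain ⟨a, b, ha, hb, he, -, -, hsa, hsb⟩ := hs.exists_expected_bounds hjm hji hjq' hx₀' hS
      (hxs₀.mem_dom hQ hg hx₀') hys (hE0 xs₀ ys hxs₀)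
    simp only [hF, hFs]
    exact SemiRandPD.liminf_sq_mul_sqrt_log_eq_zero (add_nonneg hg.1 (norm_nonneg ys)) ha hb
      (fun k => integral_nonneg fun ω => sub_nonneg.2 (hxs₀.FR_le hQ hg (hdom ω k))) he hsa hsb
  refine ⟨fun k => ⟨Eventually.of_forall fun ω =>
    (SemiRandPD.Problem.F_ne_top_iff hQ hg).2 (hdom ω k), by simpa only [hF] using hint k⟩,
    fun xs ys hxs hys k => ?_, hlim, ?_⟩
  · obtain ⟨a, b, ha, hb, he, hra, hrb, -, -⟩ := hs.exists_expected_bounds hjm hji hjq' hx₀' hS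
      (hxs.mem_dom hQ hg hx₀') (hys.isMultiplier hQ hg hxs hx₀') (hE0 xs ys hxs)
    simp only [hF, hxs.Fstar_eq hQ hg hx₀']
    set E := SemiRandPD.E0sq Q μ L σ q τ₀ ρ₀ x₀ xs yh₀ ys
    have hsc := SemiRandPD.scale_pos hc k
    set s := SemiRandPD.scale c k with hs_def
    have hE : 0 ≤ E := (mul_nonneg (sq_nonneg s) (ha k)).trans (hra k)
    have h1 : a k ≤ E / s ^ 2 := by
      rw [le_div_iff₀ (by positivity), mul_comm]; exact hra k
    -- This comes from `(ρ₀/2) s⁴ b_k ≤ E`; a square root leaves the same power `s²` as in the bound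
    -- on the gap.
    have h2 : √(b k) ≤ √E * √(2 / ρ₀) / s ^ 2 := by
      rw [le_div_iff₀ (by positivity), ← Real.sqrt_mul hE]
      refine Real.le_sqrt_of_sq_le ?_
      rw [mul_pow, Real.sq_sqrt (hb k)]
      have h3 := mul_le_mul_of_nonneg_right (hrb k) (by positivity : 0 ≤ 2 / ρ₀)
      have h4 : ρ₀ / 2 * (s ^ 4 * b k) * (2 / ρ₀) = b k * (s ^ 2) ^ 2 := by
        field_simp
      rwa [h4] at h3
    have hM : 0 ≤ Mg + ‖ys‖ := add_nonneg hg.1 (norm_nonneg _)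
    have hk : (0 : ℝ) < k + c - 1 := by
      have : (0 : ℝ) ≤ k := k.cast_nonneg
      linarith
    calc ∫ ω, (Q.FR ((S ω).x k) - Q.FR xs) ∂P ≤ a k + (Mg + ‖ys‖) * √(b k) := he k
      _ ≤ E / s ^ 2 + (Mg + ‖ys‖) * (√E * √(2 / ρ₀) / s ^ 2) := by gcongr
      _ = (c ^ 2 * E + c ^ 2 * (Mg + ‖ys‖) * √E * √(2 / ρ₀)) / ((k : ℝ) + c - 1) ^ 2 := by
        rw [hs_def, SemiRandPD.scale]
        have : c ≠ 0 := by linarith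
        field_simp
  · rw [SemiRandPD.IsLiminfLittleO, ← hlim]
    congr 1
    funext k
    have h1 : ∫ ω, ((Q.F ((S ω).x k)).toReal - Q.Fstar.toReal) ∂P
        = (∫ ω, (Q.F ((S ω).x k)).toReal ∂P) - Q.Fstar.toReal := by
      rw [integral_sub (by simpa only [hF] using hint k) (integrable_const _), integral_const,
        probReal_univ, one_smul]
    -- The identity also holds at `k = 0` and `k = 1`, where both sides vanish by the convention for
    -- division by zero.
    rw [h1, div_div_eq_mul_div, div_one, mul_comm]
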